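/- Let $\mathbb{D}$ be the open unit disc and $\mathcal{H}(\mathbb{D})$ the space of analytic functions in $\mathbb{D}$. For a measurable $f$ on $\mathbb{D}$, $0\le r<1$ and $0<p<\infty$ put $$M_p(r,f)=\Big(\int_0^{2\pi}|f(re^{i\theta})|^p\,\tfrac{d\theta}{2\pi}\Big)^{1/p},\qquad M_\infty(r,f)=\sup_{|z|=r}|f(z)|.$$ A radial weight is a non-negative function $\omega\in L^1([0,1))$ such that $\widehat\omega(r)=\int_r^1\omega(x)\,dx>0$ for all $0\le r<1$; write $\widehat\omega(z)=\widehat\omega(|z|)$ for $z\in\mathbb{D}$. The class $\mathcal{D}$ consists of the radial weights $\omega$ for which there are a constant $C>0$ with $\widehat\omega(r)\le C\,\widehat\omega\big(\tfrac{1+r}{2}\big)$ for all $0\le r<1$, and constants $K>1$, $C'>1$ with $\widehat\omega(r)\ge C'\,\widehat\omega\big(1-\tfrac{1-r}{K}\big)$ for all $0\le r<1$. For $0<p\le\infty$ and $0<q<\infty$ let $L^{p,q}_\omega$ be the space of measurable functions $f$ on $\mathbb{D}$ with $$\|f\|_{L^{p,q}_\omega}=\Big(\int_0^1 M_p^q(r,f)\,\omega(r)\,dr\Big)^{1/q}<\infty,$$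 and let $A^{p,q}_\omega=\mathcal{H}(\mathbb{D})\cap L^{p,q}_\omega$ with the same (quasi-)norm. For $g\in\mathcal{H}(\mathbb{D})$ let $T_gf(z)=\int_0^z f(\zeta)g'(\zeta)\,d\zeta$. **Proposition.** Let $0<p,q,s,t<\infty$, $\omega\in\mathcal{D}$ and $g\in\mathcal{H}(\mathbb{D})$, and write $\frac1{\tilde p}=\frac1s-\frac1p$ and $\frac1{\tilde q}=\frac1t-\frac1q$ (if $p=s$ or $q=t$, the symbol $\frac1{\tilde p}$ or $\frac1{\tilde q}$ just denotes $0$). Then each of the following conditions is sufficient for $T_g:A^{p,q}_\omega\to A^{s,t}_\omega$ to be bounded: (a) $p\le s$, $q\le t$ and $\sup_{z\in\mathbb{D}}|g'(z)|\,\widehat\omega(z)^{1/\tilde q}(1-|z|)^{1+1/\tilde p}<\infty$; (b) $s<p$, $q\le t$ and $\sup_{0\le r<1}(1-r)\,\widehat\omega(r)^{1/\tilde q}M_{\tilde p}(r,g')<\infty$; (c) $p\le s$, $t<q$ and $|g'(z)|(1-|z|)^{1+1/\tilde p}\in L^{\infty,\tilde q}_\omega$; (d) $s<p$, $t<q$ and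 $g\in A^{\tilde p,\tilde q}_\omega$. Moreover, there is a constant $C>0$, depending only on $p,q,s,t$ and $\omega$, such that for every $g\in\mathcal{H}(\mathbb{D})$ $$\|T_g\|_{A^{p,q}_\omega\to A^{s,t}_\omega}\le C\,\rho_{p,q,s,t,\omega}(g),$$ where $$\rho_{p,q,s,t,\omega}(g)=\begin{cases}\sup_{z\in\mathbb{D}}|g'(z)|\,\widehat\omega(z)^{1/\tilde q}(1-|z|)^{1+1/\tilde p}, & p\le s,\ q\le t,\\ \sup_{0\le r<1}(1-r)\,\widehat\omega(r)^{1/\tilde q}M_{\tilde p}(r,g'), & s<p,\ q\le t,\\ \big\|(1-|\cdot|)^{1+1/\tilde p}g'\big\|_{L^{\infty,\tilde q}_\omega}, & p\le s,\ t<q,\\ \|g-g(0)\|_{A^{\tilde p,\tilde q}_\omega}, & s<p,\ t<q,\end{cases}$$ all quantities taking values in $[0,\infty]$. -/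

import Mathlib

open MeasureTheory Set Metric
open scoped ENNReal NNReal

noncomputable section

namespace MixedNorm

/-- The tail integral `ω̂(r) = ∫_r^1 ω(x) dx` of a radial profile `ω`; for `z` in the disc,
`ω̂(z) = ω̂(|z|)`. -/
def tail (ω : ℝ → ℝ) (r : ℝ) : ℝ := ∫ x in Ico r 1, ω x

/-- `ω` is (the profile on `[0,1)` of) a radial weight: a non-negative function in `L¹([0,1))`
whose tail integrals are all positive. Values of `ω` outside `[0,1)` play no role. -/
structure IsRadialWeight (ω : ℝ → ℝ) : Prop where
  nonneg : ∀ r ∈ Ico (0 : ℝ) 1, 0 ≤ ω r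
  integrableOn : IntegrableOn ω (Ico 0 1)
  tail_pos : ∀ r ∈ Ico (0 : ℝ) 1, 0 < tail ω r

/-- The class `D̂`. -/
def IsUpperDoubling (ω : ℝ → ℝ) : Prop :=
  IsRadialWeight ω ∧
    ∃ C : ℝ, 0 < C ∧ ∀ r ∈ Ico (0 : ℝ) 1, tail ω r ≤ C * tail ω ((1 + r) / 2)

/-- The class `Ď`. -/
def IsLowerDoubling (ω : ℝ → ℝ) : Prop :=
  IsRadialWeight ω ∧
    ∃ K C : ℝ, 1 < K ∧ 1 < C ∧
      ∀ r ∈ Ico (0 : ℝ) 1, C * tail ω (1 - (1 - r) / K) ≤ tail ω r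

/-- Radial doubling weights: `D = D̂ ∩ Ď`. -/
def IsDoubling (ω : ℝ → ℝ) : Prop := IsUpperDoubling ω ∧ IsLowerDoubling ω

/-- The integral mean `M_p(r,f)`, with values in `[0,∞]`, for `0 < p ≤ ∞`. -/
def mean (p : ℝ≥0∞) (r : ℝ) (f : ℂ → ℂ) : ℝ≥0∞ :=
  if p = ∞ then ⨆ z ∈ sphere (0 : ℂ) r, ‖f z‖ₑ
  else ((∫⁻ θ in Ioc (0 : ℝ) (2 * Real.pi), ‖f (circleMap 0 r θ)‖ₑ ^ p.toReal)
    / ENNReal.ofReal (2 * Real.pi)) ^ (1 / p.toReal)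

/-- The mixed (quasi-)norm `‖f‖ = (∫_0^1 M_p(r,f)^q ω(r) dr)^(1/q)`, with values in `[0,∞]`. -/
def mixedNorm (ω : ℝ → ℝ) (p : ℝ≥0∞) (q : ℝ) (f : ℂ → ℂ) : ℝ≥0∞ :=
  (∫⁻ r in Ico (0 : ℝ) 1, mean p r f ^ q * ENNReal.ofReal (ω r)) ^ (1 / q)

/-- The space `L^{p,q}_ω`: functions measurable on the unit disc with finite mixed norm. -/
def L (ω : ℝ → ℝ) (p : ℝ≥0∞) (q : ℝ) : Set (ℂ → ℂ) :=
  {f | Measurable ((ball (0 : ℂ) 1).domRestrict f) ∧ mixedNorm ω p q f < ∞}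

/-- The functions which are analytic in the unit disc (values off the disc play no role). -/
def H : Set (ℂ → ℂ) := {f | DifferentiableOn ℂ f (ball 0 1)}

/-- The analytic mixed norm space `A^{p,q}_ω = H(𝔻) ∩ L^{p,q}_ω`. -/
def A (ω : ℝ → ℝ) (p : ℝ≥0∞) (q : ℝ) : Set (ℂ → ℂ) := H ∩ L ω p q

/-- The operator `T_g f (z) = ∫_0^z f(ζ) g'(ζ) dζ`, the integral being taken along the segment
`ζ = x z`, `0 ≤ x ≤ 1`. -/
def T (g f : ℂ → ℂ) (z : ℂ) : ℂ :=
  z * ∫ x in (0 : ℝ)..1, f ((x : ℂ) * z) * deriv g ((x : ℂ) * z)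

/-- `Φ` is a bounded operator from `A^{p,q}_ω` to `A^{s,t}_ω`. -/
def IsBoundedOp (ω : ℝ → ℝ) (p : ℝ≥0∞) (q : ℝ) (s : ℝ≥0∞) (t : ℝ)
    (Φ : (ℂ → ℂ) → (ℂ → ℂ)) : Prop :=
  MapsTo Φ (A ω p q) (A ω s t) ∧
    ∃ C : ℝ≥0, ∀ f ∈ A ω p q, mixedNorm ω s t (Φ f) ≤ C * mixedNorm ω p q f

/-- The operator norm of `Φ` from `A^{p,q}_ω` to `A^{s,t}_ω`: the least admissible constant. -/
def opNorm (ω : ℝ → ℝ) (p : ℝ≥0∞) (q : ℝ) (s : ℝ≥0∞) (t : ℝ)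
    (Φ : (ℂ → ℂ) → (ℂ → ℂ)) : ℝ≥0∞ :=
  sInf {C : ℝ≥0∞ | ∀ f ∈ A ω p q, mixedNorm ω s t (Φ f) ≤ C * mixedNorm ω p q f}

/-- The number `1/p̃ = 1/s - 1/p`. -/
def invTilde (p s : ℝ) : ℝ := 1 / s - 1 / p

/-- The exponent `p̃`, defined by `1/p̃ = 1/s - 1/p`; it is used only for `s < p`,
where it is a positive real number. -/
def tilde (p s : ℝ) : ℝ := (invTilde p s)⁻¹

/-- `sup_{z ∈ 𝔻} |g'(z)| ω̂(z)^{1/q̃} (1-|z|)^{1+1/p̃}`, with values in `[0,∞]`. -/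
def supDisc (ω : ℝ → ℝ) (p q s t : ℝ) (g : ℂ → ℂ) : ℝ≥0∞ :=
  ⨆ z ∈ ball (0 : ℂ) 1, ENNReal.ofReal
    (‖deriv g z‖ * tail ω ‖z‖ ^ invTilde q t * (1 - ‖z‖) ^ (1 + invTilde p s))

/-- `sup_{0 ≤ r < 1} (1-r) ω̂(r)^{1/q̃} M_{p̃}(r,g')`, with values in `[0,∞]`. -/
def supMean (ω : ℝ → ℝ) (p q s t : ℝ) (g : ℂ → ℂ) : ℝ≥0∞ :=
  ⨆ r ∈ Ico (0 : ℝ) 1, ENNReal.ofReal ((1 - r) * tail ω r ^ invTilde q t) *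
    mean (ENNReal.ofReal (tilde p s)) r (deriv g)

/-- The quantity `ρ_{p,q,s,t,ω}(g)`. -/
def rho (ω : ℝ → ℝ) (p q s t : ℝ) (g : ℂ → ℂ) : ℝ≥0∞ :=
  if p ≤ s then
    if q ≤ t then supDisc ω p q s t g
    else mixedNorm ω ∞ (tilde q t)
      (fun z => (((1 - ‖z‖) ^ (1 + invTilde p s) : ℝ) : ℂ) * deriv g z)
  else
    if q ≤ t then supMean ω p q s t g
    else mixedNorm ω (ENNReal.ofReal (tilde p s)) (tilde q t) (fun z => g z - g 0)

end MixedNorm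

end

/-!
The estimate rests on a discretization in the radial variable. For `ω ∈ D` there is `K ≥ 2` such
that at the radii `ρ_n = 1 - K^{-n}` the tail integrals `w_n = ω̂(ρ_n)` decay geometrically: the
ratios `w_{n+1} / w_n` stay away from `0` and from `1` (`exists_isGrid`). As the integral means
`M_p(r, f)` of an analytic function increase with `r`, this gives `‖f‖^q ≍ ∑ M_p(ρ_n, f)^q w_n` in
`A^{p,q}_ω` (`IsGrid.lintegral_le_tsum`, `IsGrid.tsum_le_lintegral`).

All function theory comes from the sub-mean value property of `|f|^p` for every `p > 0`, which
follows from Jensen's formula and the convexity of the exponential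
(`norm_rpow_le_circleAverage`). It yields the monotonicity of `M_p`
(`circleAverage_norm_rpow_monotoneOn`), the growth estimate that passes from `M_p` to `M_s` for
`p ≤ s` (`mean_le_mean_of_le`), and a local maximal inequality (`exists_rotation_majorant`): the
`p`-th power of the maximum of `|h|` over a disc of radius comparable to the distance to the
boundary, averaged over rotations of the disc, is at most a constant times `M_p(R, h)^p`.

The function `F = T_g f` satisfies `F(0) = 0` and `F' = f g'`. By the maximal inequality for `F'`,
`M_s(ρ_{n+1}, F)^t ≤ η M_s(ρ_n, F)^t + C (K^{-n} M_s(ρ_{n+2}, F'))^t` with `η > 1` as close to `1`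
as desired. Multiplying by `w_{n+1}` turns `η` into a factor below `1`, so summation over `n` gives
`‖F‖^t ≲ ∑ (K^{-n} M_s(ρ_n, F'))^t w_n` (`IsGrid.exists_mixedNorm_le`).

It remains to estimate this sum for `F' = f g'`. If `s < p`, Hölder's inequality gives
`M_s(f g') ≤ M_p(f) M_p̃(g')`; if `p ≤ s`, the growth estimate and `M_s(f g') ≤ M_s(f) M_∞(g')` are
used. Either way `K^{-n} M_s(ρ_n, f g') ≲ a_n b_n`, where `a_n = M_p(ρ_{n+1}, f)` and `b_n` depends
on `g'` only. The sum of `(a_n b_n)^t w_n` is then treated by the inclusion of `ℓ^q` in `ℓ^t` if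
`q ≤ t`, and by Hölder's inequality if `t < q` (`tsum_mul_rpow_le`). In each of the four cases the
resulting quantity in `b_n` is dominated by `ρ_{p,q,s,t,ω}(g)`; for `s < p`, `t < q` this uses
Cauchy's estimate for `M_p̃(g')`.
-/

noncomputable section

namespace MixedNorm

/-! ### Subharmonicity of `|f|^p` and monotonicity of the integral means -/

/-- Sub-mean value property of `|f|^p`, from Jensen's formula and convexity of `exp`. -/
theorem norm_rpow_le_circleAverage {f : ℂ → ℂ} {c : ℂ} {R p : ℝ} (hR : 0 < R) (hp : 0 < p)
    (hf : AnalyticOnNhd ℂ f (closedBall c R)) :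
    ‖f c‖ ^ p ≤ Real.circleAverage (fun z => ‖f z‖ ^ p) c R := by
  by_cases h0 : f c = 0
  · rw [h0, norm_zero, Real.zero_rpow hp.ne']
    exact Real.circleAverage_nonneg_of_nonneg fun x _ => by positivity
  have hf' : AnalyticOnNhd ℂ f (closedBall c |R|) := by rwa [abs_of_pos hR]
  have hJ : Real.log ‖f c‖ ≤ Real.circleAverage (Real.log ‖f ·‖) c R := by
    -- in Jensen's formula the zeros in the disc contribute non-negative terms
    rw [hf'.circleAverage_log_norm hR.ne' h0]
    refine le_add_of_nonneg_left (finsum_nonneg fun u => ?_)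
    by_cases hu : u ∈ closedBall c |R|
    · refine mul_nonneg ?_ ?_
      · exact_mod_cast (MeromorphicOn.AnalyticOnNhd.divisor_nonneg hf') u
      · rcases eq_or_ne ‖c - u‖ 0 with h | h
        · simp [h]
        · apply Real.log_nonneg
          rw [mem_closedBall, abs_of_pos hR, dist_comm, dist_eq_norm] at hu
          have := (norm_nonneg (c - u)).lt_of_ne' h
          rw [← div_eq_mul_inv, le_div_iff₀ this]
          linarith
    · simp [hu]
  have hlogint : CircleIntegrable (Real.log ‖f ·‖) c R :=
    MeromorphicOn.circleIntegrable_log_norm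
      (hf'.meromorphicOn.mono_set sphere_subset_closedBall)
  set a := ‖f c‖
  have ha0 : 0 < a := norm_pos_iff.2 h0
  -- the tangent-line minorant of `x ^ p = exp (p log x)` at `x = a`
  let m : ℂ → ℝ := fun z => a ^ p * p * Real.log ‖f z‖ + a ^ p * (1 - p * Real.log a)
  -- Since `Real.log 0 = 0`, `m` need not be below `‖f ·‖ ^ p` at zeros of `f`; they form a
  -- discrete set, on which `‖f ·‖ ^ p` may be modified without changing its average.
  let G : ℂ → ℝ := fun z => if f z = 0 then m z else ‖f z‖ ^ p
  have hG : (fun z => ‖f z‖ ^ p) =ᶠ[Filter.codiscreteWithin (sphere c |R|)] G := by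
    have h1 := AnalyticOnNhd.preimage_zero_mem_codiscreteWithin hf' (x := c) h0 (by simp)
      ((convex_closedBall c |R|).isConnected ⟨c, by simp⟩)
    filter_upwards [Filter.codiscreteWithin_mono sphere_subset_closedBall h1] with z hz
    have hz' : f z ≠ 0 := hz
    simp [G, hz']
  have hmint : CircleIntegrable m c R :=
    (hlogint.const_mul _).add (circleIntegrable_const _ c R)
  have hfint : CircleIntegrable (fun z => ‖f z‖ ^ p) c R := by
    refine ContinuousOn.circleIntegrable hR.le ?_
    exact ((hf.continuousOn.mono sphere_subset_closedBall).norm).rpow_const fun _ _ => Or.inr hp.le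
  have hmG : ∀ z ∈ sphere c |R|, m z ≤ G z := by
    intro z _
    by_cases hz : f z = 0
    · simp [G, hz]
    · have hz0 : 0 < ‖f z‖ := norm_pos_iff.2 hz
      simp only [G, hz, if_false, m]
      have h2 := Real.add_one_le_exp (p * (Real.log ‖f z‖ - Real.log a))
      have h3 : ‖f z‖ ^ p = a ^ p * Real.exp (p * (Real.log ‖f z‖ - Real.log a)) := by
        rw [Real.rpow_def_of_pos hz0, Real.rpow_def_of_pos ha0, ← Real.exp_add]
        congr 1; ring
      rw [h3]
      have h4 : 0 < a ^ p := Real.rpow_pos_of_pos ha0 p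
      nlinarith
  rw [Real.circleAverage_congr_codiscreteWithin hG hR.ne']
  refine le_trans ?_ (Real.circleAverage_mono hmint (hfint.congr_codiscreteWithin hG) hmG)
  have h5 : Real.circleAverage m c R
      = a ^ p * p * Real.circleAverage (Real.log ‖f ·‖) c R + a ^ p * (1 - p * Real.log a) := by
    have := Real.circleAverage_fun_add (f₁ := fun z => (a ^ p * p) • Real.log ‖f z‖)
      (f₂ := fun _ => a ^ p * (1 - p * Real.log a)) (c := c) (R := R) (hlogint.const_mul _)
      (circleIntegrable_const _ c R)
    rw [Real.circleAverage_const, Real.circleAverage_fun_smul] at this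
    exact this
  rw [h5]
  have h6 : 0 ≤ a ^ p * p := by positivity
  nlinarith [mul_le_mul_of_nonneg_left hJ h6]

theorem circleMap_zero_add_arg (z : ℂ) (θ : ℝ) :
    circleMap 0 ‖z‖ (θ + z.arg) = z * circleMap 0 1 θ := by
  conv_rhs => rw [← Complex.norm_mul_exp_arg_mul_I z]
  simp only [circleMap_zero, Complex.ofReal_add, add_mul, Complex.exp_add, Complex.ofReal_one]
  ring

/-- The average of `F` over the circle through `z` centred at the origin, parametrized by
rotations of `z`. -/
theorem circleAverage_zero_norm (F : ℂ → ℝ) (z : ℂ) :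
    Real.circleAverage F 0 ‖z‖
      = (2 * Real.pi)⁻¹ • ∫ θ in (0 : ℝ)..2 * Real.pi, F (z * circleMap 0 1 θ) := by
  rw [Real.circleAverage_eq_integral_add z.arg]
  simp only [circleMap_zero_add_arg]

/-- The radial function `z ↦ M_p(|z|, f)^p` inherits the sub-mean value property. -/
theorem circleAverage_norm_rpow_le {f : ℂ → ℂ} (hf : DifferentiableOn ℂ f (ball 0 1)) {p : ℝ}
    (hp : 0 < p) {z : ℂ} {ε : ℝ} (hε : 0 < ε) (hz : ‖z‖ + ε < 1) :
    Real.circleAverage (fun w => ‖f w‖ ^ p) 0 ‖z‖ ≤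
      Real.circleAverage (fun u => Real.circleAverage (fun w => ‖f w‖ ^ p) 0 ‖u‖) z ε := by
  have hFc : ContinuousOn (fun w => ‖f w‖ ^ p) (ball 0 1) :=
    hf.continuousOn.norm.rpow_const fun _ _ => Or.inr hp.le
  have hmem : ∀ u ∈ closedBall z ε, ∀ θ : ℝ, u * circleMap 0 1 θ ∈ ball (0 : ℂ) 1 := by
    intro u hu θ
    rw [mem_closedBall, dist_eq_norm] at hu
    have : ‖u‖ ≤ ‖z‖ + ‖u - z‖ := by simpa using norm_add_le z (u - z)
    simp only [mem_ball, dist_zero_right, norm_mul, norm_circleMap_zero, abs_one, mul_one]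
    linarith
  have hcont : Continuous (Function.uncurry fun θ φ : ℝ =>
      ‖f (circleMap z ε φ * circleMap 0 1 θ)‖ ^ p) := by
    refine hFc.comp_continuous (f := fun x : ℝ × ℝ => circleMap z ε x.2 * circleMap 0 1 x.1)
      (by fun_prop) fun x => hmem _ (circleMap_mem_closedBall z hε.le x.2) x.1
  rw [circleAverage_zero_norm]
  simp only [circleAverage_zero_norm]
  simp only [Real.circleAverage, smul_eq_mul]
  rw [intervalIntegral.integral_const_mul]
  refine mul_le_mul_of_nonneg_left ?_ (by positivity)
  rw [intervalIntegral_intervalIntegral_swap (F := fun φ θ : ℝ =>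
    ‖f (circleMap z ε φ * circleMap 0 1 θ)‖ ^ p), ← intervalIntegral.integral_const_mul]
  · refine intervalIntegral.integral_mono_on (by positivity) ?_ ?_ ?_
    · refine Continuous.intervalIntegrable ?_ _ _
      exact hFc.comp_continuous (by fun_prop) fun θ => hmem z (by simp [hε.le]) θ
    · refine Continuous.intervalIntegrable ?_ _ _
      exact continuous_const.mul
        (intervalIntegral.continuous_parametric_intervalIntegral_of_continuous' hcont _ _)
    · intro θ _
      have := norm_rpow_le_circleAverage (f := fun u => f (u * circleMap 0 1 θ)) (c := z) hε hp
        (by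
          refine (DifferentiableOn.analyticOnNhd (s := ball z (1 - ‖z‖)) ?_ isOpen_ball).mono
            (closedBall_subset_ball (by linarith))
          refine hf.comp (by fun_prop) fun u hu => ?_
          rw [mem_ball, dist_eq_norm] at hu
          have : ‖u‖ ≤ ‖z‖ + ‖u - z‖ := by simpa using norm_add_le z (u - z)
          simp only [mem_ball, dist_zero_right, norm_mul, norm_circleMap_zero, abs_one, mul_one]
          linarith)
      simpa [Real.circleAverage] using this
  · refine (Continuous.continuousOn ?_).integrableOn_compact (isCompact_uIcc.prod isCompact_uIcc)
      |>.mono_set (prod_mono uIoc_subset_uIcc uIoc_subset_uIcc)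
    exact hFc.comp_continuous (f := fun x : ℝ × ℝ => circleMap z ε x.1 * circleMap 0 1 x.2)
      (by fun_prop) fun x => hmem _ (circleMap_mem_closedBall z hε.le x.1) x.2

/-- **Hardy's theorem**: `r ↦ M_p(r, f)` is increasing. A radial function with the sub-mean value
property satisfies the maximum principle: if the maximum over `[0, R]` is attained
at an interior point, the largest such point contradicts the sub-mean value property. -/
theorem circleAverage_norm_rpow_monotoneOn {f : ℂ → ℂ} (hf : DifferentiableOn ℂ f (ball 0 1))
    {p : ℝ} (hp : 0 < p) :
    MonotoneOn (Real.circleAverage (fun w => ‖f w‖ ^ p) 0) (Ico 0 1) := by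
  set v := Real.circleAverage (fun w => ‖f w‖ ^ p) 0
  have hvc : ContinuousOn v (Ico 0 1) := by
    refine Real.ContinuousOn.circleAverage ?_ fun r hr => hr.1
    refine (hf.continuousOn.norm.rpow_const fun _ _ => Or.inr hp.le).mono fun z hz => ?_
    simpa using hz.2
  intro r hr R hR hrR
  by_contra! hlt
  have hsub : Icc 0 R ⊆ Ico (0 : ℝ) 1 := fun x hx => ⟨hx.1, hx.2.trans_lt hR.2⟩
  obtain ⟨x₁, hx₁, hmax⟩ := isCompact_Icc.exists_isMaxOn (nonempty_Icc.2 hR.1) (hvc.mono hsub)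
  have hcomp : IsCompact (Icc 0 R ∩ v ⁻¹' {v x₁}) :=
    isCompact_Icc.of_isClosed_subset
      ((hvc.mono hsub).preimage_isClosed_of_isClosed isClosed_Icc isClosed_singleton)
      inter_subset_left
  obtain ⟨x₀, ⟨hx₀, hx₀v⟩, hgreat⟩ := hcomp.exists_isGreatest ⟨x₁, hx₁, rfl⟩
  have hx₀v : v x₀ = v x₁ := hx₀v
  have hx₀R : x₀ < R := by
    refine lt_of_le_of_ne hx₀.2 fun h => ?_
    have h1 : v r ≤ v x₁ := hmax ⟨hr.1, hrR⟩
    rw [← hx₀v, h] at h1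
    exact absurd h1 hlt.not_ge
  set ε := R - x₀ with hε
  have hε0 : 0 < ε := sub_pos.2 hx₀R
  have hnx : ‖(x₀ : ℂ)‖ = x₀ := by simp [abs_of_nonneg hx₀.1]
  have hs := circleAverage_norm_rpow_le hf hp (z := (x₀ : ℂ)) hε0 (by
    rw [hnx]; linarith [hR.2])
  rw [hnx] at hs
  refine absurd hs (not_le.2 ?_)
  have hnc : ∀ θ : ℝ, ‖circleMap (x₀ : ℂ) ε θ‖ ∈ Icc 0 R := fun θ => ⟨norm_nonneg _, by
    refine (norm_add_le _ _).trans ?_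
    have : ‖(ε : ℂ) * Complex.exp (θ * Complex.I)‖ = ε := by
      rw [norm_mul, Complex.norm_exp_ofReal_mul_I, Complex.norm_real, Real.norm_eq_abs,
        abs_of_pos hε0, mul_one]
    rw [hnx, this]; linarith⟩
  change Real.circleAverage (fun u => v ‖u‖) x₀ ε < v x₀
  rw [← Real.circleAverage_const (v x₀) (x₀ : ℂ) ε]
  simp only [Real.circleAverage, smul_eq_mul]
  refine mul_lt_mul_of_pos_left ?_ (by positivity)
  refine intervalIntegral.integral_lt_integral_of_continuousOn_of_le_of_exists_lt (by positivity)
    (Continuous.continuousOn ?_) continuousOn_const (fun θ _ => ?_) ⟨0, ⟨le_rfl, by positivity⟩, ?_⟩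
  · exact hvc.comp_continuous (by fun_prop) fun θ => hsub (hnc θ)
  · rw [hx₀v]; exact hmax (hnc θ)
  · have h0 : ‖circleMap (x₀ : ℂ) ε 0‖ = R := by
      simp only [circleMap, Complex.ofReal_zero, zero_mul, Complex.exp_zero, mul_one]
      rw [← Complex.ofReal_add, Complex.norm_real, Real.norm_eq_abs, hε]
      rw [abs_of_nonneg] <;> linarith [hR.1]
    rw [h0, hx₀v]
    refine lt_of_le_of_ne (hmax ⟨hR.1, le_rfl⟩) fun h => ?_
    exact absurd (hgreat ⟨⟨hR.1, le_rfl⟩, h⟩) hx₀R.not_ge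

/-! ### Circle averages of extended non-negative functions -/

/-- The average of a `[0,∞]`-valued function over the circle with centre `c` and radius `r`. -/
def circleLAverage (F : ℂ → ℝ≥0∞) (c : ℂ) (r : ℝ) : ℝ≥0∞ :=
  (∫⁻ θ in Ioc (0 : ℝ) (2 * Real.pi), F (circleMap c r θ)) / ENNReal.ofReal (2 * Real.pi)

/-- The `p`-th power `M_p(r, f)^p` of the integral mean. -/
def powMean (p r : ℝ) (f : ℂ → ℂ) : ℝ≥0∞ := circleLAverage (fun z => ‖f z‖ₑ ^ p) 0 r

theorem mean_ofReal {p : ℝ} (hp : 0 < p) (r : ℝ) (f : ℂ → ℂ) :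
    mean (ENNReal.ofReal p) r f = powMean p r f ^ (1 / p) := by
  simp [mean, powMean, circleLAverage, ENNReal.toReal_ofReal hp.le]

theorem ofReal_two_pi_pos : ENNReal.ofReal (2 * Real.pi) ≠ 0 := by
  simp [Real.pi_pos]

theorem lintegral_circleMap_eq (F : ℂ → ℝ≥0∞) (c : ℂ) (r : ℝ) :
    ∫⁻ θ in Ioc (0 : ℝ) (2 * Real.pi), F (circleMap c r θ)
      = ENNReal.ofReal (2 * Real.pi) * circleLAverage F c r := by
  rw [circleLAverage, ENNReal.mul_div_cancel ofReal_two_pi_pos ENNReal.ofReal_ne_top]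

/-- The integral over one period does not depend on the period interval. -/
theorem setLIntegral_Ioc_periodic {F : ℝ → ℝ≥0∞} {T : ℝ} (hT : 0 < T) (hF : Function.Periodic F T)
    (a b : ℝ) : ∫⁻ θ in Ioc a (a + T), F θ = ∫⁻ θ in Ioc b (b + T), F θ := by
  refine (isAddFundamentalDomain_Ioc hT a).setLIntegral_eq (isAddFundamentalDomain_Ioc hT b) F ?_
  rintro ⟨g, hg⟩ x
  obtain ⟨n, rfl⟩ := AddSubgroup.mem_zmultiples_iff.1 hg
  have := hF.zsmul n x
  simpa [AddSubgroup.vadd_def, add_comm] using this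

theorem lintegral_mul_circleMap (F : ℂ → ℝ≥0∞) (z : ℂ) :
    ∫⁻ θ in Ioc (0 : ℝ) (2 * Real.pi), F (z * circleMap 0 1 θ)
      = ENNReal.ofReal (2 * Real.pi) * circleLAverage F 0 ‖z‖ := by
  rw [← lintegral_circleMap_eq]
  simp only [← circleMap_zero_add_arg]
  have h1 : ∫⁻ θ in Ioc (0 : ℝ) (2 * Real.pi), F (circleMap 0 ‖z‖ (θ + z.arg))
      = ∫⁻ θ in Ioc z.arg (z.arg + 2 * Real.pi), F (circleMap 0 ‖z‖ θ) := by
    have := (measurePreserving_add_right volume z.arg).setLIntegral_comp_emb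
      (measurableEmbedding_addRight z.arg) (fun θ => F (circleMap 0 ‖z‖ θ)) (Ioc 0 (2 * Real.pi))
    rw [this]
    simp [add_comm]
  rw [h1, setLIntegral_Ioc_periodic Real.two_pi_pos _ z.arg 0, zero_add]
  intro θ
  simp [periodic_circleMap 0 ‖z‖ θ]

theorem ofReal_circleAverage {F : ℂ → ℝ} {c : ℂ} {r : ℝ} (hr : 0 ≤ r)
    (hF : ContinuousOn F (sphere c r)) (h0 : ∀ z, 0 ≤ F z) :
    ENNReal.ofReal (Real.circleAverage F c r)
      = circleLAverage (fun z => ENNReal.ofReal (F z)) c r := by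
  have hc : Continuous fun θ => F (circleMap c r θ) :=
    hF.comp_continuous (by fun_prop) fun θ => circleMap_mem_sphere c hr θ
  rw [Real.circleAverage, circleLAverage, smul_eq_mul, ENNReal.ofReal_mul (by positivity),
    intervalIntegral.integral_of_le Real.two_pi_pos.le, ofReal_integral_eq_lintegral_ofReal
      (hc.integrableOn_Ioc) (Filter.Eventually.of_forall fun θ => h0 _),
    ENNReal.ofReal_inv_of_pos Real.two_pi_pos, mul_comm, ENNReal.div_eq_inv_mul, mul_comm]

theorem ofReal_norm_rpow {p : ℝ} (hp : 0 < p) (z : ℂ) :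
    ENNReal.ofReal (‖z‖ ^ p) = ‖z‖ₑ ^ p := by
  rw [← ofReal_norm, ENNReal.ofReal_rpow_of_nonneg (norm_nonneg z) hp.le]

theorem circleLAverage_norm_rpow {f : ℂ → ℂ} {c : ℂ} {r p : ℝ} (hr : 0 ≤ r) (hp : 0 < p)
    (hf : ContinuousOn f (sphere c r)) :
    circleLAverage (fun z => ‖f z‖ₑ ^ p) c r
      = ENNReal.ofReal (Real.circleAverage (fun z => ‖f z‖ ^ p) c r) := by
  rw [ofReal_circleAverage hr (hf.norm.rpow_const fun _ _ => Or.inr hp.le)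
    fun z => by positivity]
  simp only [ofReal_norm_rpow hp]

theorem sphere_subset_unitBall {r : ℝ} (hr : r ∈ Ico (0 : ℝ) 1) : sphere (0 : ℂ) r ⊆ ball 0 1 :=
  fun z hz => by simp only [mem_sphere, dist_zero_right] at hz; simp [hz, hr.2]

theorem powMean_ne_top {f : ℂ → ℂ} (hf : ContinuousOn f (ball 0 1)) {p r : ℝ} (hp : 0 < p)
    (hr : r ∈ Ico (0 : ℝ) 1) : powMean p r f ≠ ∞ := by
  rw [powMean, circleLAverage_norm_rpow hr.1 hp (hf.mono (sphere_subset_unitBall hr))]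
  exact ENNReal.ofReal_ne_top

theorem powMean_monotoneOn {f : ℂ → ℂ} (hf : DifferentiableOn ℂ f (ball 0 1)) {p : ℝ}
    (hp : 0 < p) : MonotoneOn (fun r => powMean p r f) (Ico 0 1) := by
  intro r hr R hR hrR
  simp only [powMean]
  rw [circleLAverage_norm_rpow hr.1 hp (hf.continuousOn.mono (sphere_subset_unitBall hr)),
    circleLAverage_norm_rpow hR.1 hp (hf.continuousOn.mono (sphere_subset_unitBall hR))]
  exact ENNReal.ofReal_le_ofReal (circleAverage_norm_rpow_monotoneOn hf hp hr hR hrR)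

/-! ### Sub-mean value property over discs and the local maximal inequality -/

/-- Integration in polar coordinates, in terms of circle averages. -/
theorem lintegral_eq_lintegral_circleLAverage {F : ℂ → ℝ≥0∞} (hF : Measurable F) :
    ∫⁻ z, F z = ∫⁻ r in Ioi (0 : ℝ),
      ENNReal.ofReal r * (ENNReal.ofReal (2 * Real.pi) * circleLAverage F 0 r) := by
  have h1 : ∀ q : ℝ × ℝ, Complex.polarCoord.symm q = circleMap 0 q.1 q.2 := by
    intro q
    rw [Complex.polarCoord_symm_apply, circleMap_zero, Complex.exp_mul_I]
    push_cast; ring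
  rw [← Complex.lintegral_comp_polarCoord_symm, polarCoord_target,
    Measure.volume_eq_prod, ← Measure.prod_restrict]
  simp only [h1, smul_eq_mul]
  have hm : Measurable fun q : ℝ × ℝ => F (circleMap 0 q.1 q.2) := hF.comp (by fun_prop)
  have hm2 : Measurable fun q : ℝ × ℝ => ENNReal.ofReal q.1 * F (circleMap 0 q.1 q.2) :=
    (ENNReal.measurable_ofReal.comp measurable_fst).mul hm
  rw [lintegral_prod _ hm2.aemeasurable]
  refine setLIntegral_congr_fun measurableSet_Ioi fun r _ => ?_
  have hm' : Measurable fun y : ℝ => F (circleMap 0 r y) := hF.comp (by fun_prop)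
  dsimp only
  rw [lintegral_const_mul _ hm', ← lintegral_circleMap_eq]
  congr 1
  rw [setLIntegral_congr Ioo_ae_eq_Ioc]
  have h2 := setLIntegral_Ioc_periodic (F := fun θ => F (circleMap 0 r θ)) Real.two_pi_pos
    (fun θ => by simp [periodic_circleMap 0 r θ]) (-Real.pi) 0
  rw [zero_add, show -Real.pi + 2 * Real.pi = Real.pi by ring] at h2
  exact h2

theorem measurable_indicator_of_continuousOn {F : ℂ → ℝ≥0∞} {s : Set ℂ} (hs : MeasurableSet s)
    (hF : ContinuousOn F s) : Measurable (s.indicator F) := by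
  classical
  rw [← Set.piecewise_eq_indicator]
  exact hF.measurable_piecewise continuousOn_const hs

theorem continuousOn_enorm_rpow {f : ℂ → ℂ} {s : Set ℂ} (hf : ContinuousOn f s) (p : ℝ) :
    ContinuousOn (fun z => ‖f z‖ₑ ^ p) s :=
  (ENNReal.continuous_rpow_const (y := p)).comp_continuousOn hf.enorm

/-- Sub-mean value property of `|f|^p` over discs. -/
theorem enorm_rpow_mul_le_lintegral_ball {f : ℂ → ℂ} {c : ℂ} {δ p : ℝ} (hδ : 0 < δ) (hp : 0 < p)
    (hf : DifferentiableOn ℂ f (ball c δ)) :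
    ‖f c‖ₑ ^ p * ENNReal.ofReal (Real.pi * δ ^ 2) ≤ ∫⁻ z in ball c δ, ‖f z‖ₑ ^ p := by
  set F : ℂ → ℝ≥0∞ := (ball c δ).indicator fun z => ‖f z‖ₑ ^ p with hFdef
  have hF : Measurable F := measurable_indicator_of_continuousOn measurableSet_ball
    (continuousOn_enorm_rpow hf.continuousOn p)
  rw [← lintegral_indicator measurableSet_ball, ← hFdef, ← lintegral_add_left_eq_self F c,
    lintegral_eq_lintegral_circleLAverage (F := fun z => F (c + z))
      (hF.comp (measurable_const_add c))]
  have key : ∀ x ∈ Ioo (0 : ℝ) δ, ‖f c‖ₑ ^ p ≤ circleLAverage (fun z => F (c + z)) 0 x := by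
    intro x hx
    have h1 : AnalyticOnNhd ℂ f (closedBall c x) :=
      (hf.analyticOnNhd isOpen_ball).mono (closedBall_subset_ball hx.2)
    have h2 := ENNReal.ofReal_le_ofReal (norm_rpow_le_circleAverage hx.1 hp h1)
    rw [ofReal_norm_rpow hp, ← circleLAverage_norm_rpow hx.1.le hp
      (h1.continuousOn.mono sphere_subset_closedBall)] at h2
    refine h2.trans (le_of_eq ?_)
    simp only [circleLAverage]
    congr 1
    refine lintegral_congr fun θ => ?_
    have h3 : c + circleMap 0 x θ = circleMap c x θ := by simp [circleMap]
    have h4 : circleMap c x θ ∈ ball c δ := by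
      simp [dist_eq_norm, abs_of_pos hx.1, hx.2]
    rw [h3, hFdef, indicator_of_mem h4]
  calc ‖f c‖ₑ ^ p * ENNReal.ofReal (Real.pi * δ ^ 2)
      = ∫⁻ x in Ioo (0 : ℝ) δ, ENNReal.ofReal x * (ENNReal.ofReal (2 * Real.pi) * ‖f c‖ₑ ^ p) := by
        rw [lintegral_mul_const _ (by fun_prop)]
        have : ∫⁻ x in Ioo (0 : ℝ) δ, ENNReal.ofReal x = ENNReal.ofReal (δ ^ 2 / 2) := by
          rw [← ofReal_integral_eq_lintegral_ofReal (f := fun x : ℝ => x)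
            ((continuous_id.integrableOn_Icc (a := 0) (b := δ)).mono_set Ioo_subset_Icc_self)
            ((ae_restrict_iff' measurableSet_Ioo).2 (Filter.Eventually.of_forall
              fun x hx => hx.1.le)), ← integral_Ioc_eq_integral_Ioo,
            ← intervalIntegral.integral_of_le hδ.le]
          simp
        rw [this, ← mul_assoc, ← ENNReal.ofReal_mul (by positivity), mul_comm]
        congr 2; ring
    _ ≤ ∫⁻ x in Ioo (0 : ℝ) δ, ENNReal.ofReal x *
          (ENNReal.ofReal (2 * Real.pi) * circleLAverage (fun z => F (c + z)) 0 x) :=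
        setLIntegral_mono' measurableSet_Ioo fun x hx => by gcongr; exact key x hx
    _ ≤ _ := lintegral_mono_set Ioo_subset_Ioi_self

/-- Growth estimate: `|f(z)|^p ≲ M_p(R, f)^p / δ` if the `δ`-disc about `z` is in the `R`-disc. -/
theorem enorm_rpow_le_powMean {f : ℂ → ℂ} (hf : DifferentiableOn ℂ f (ball 0 1)) {p δ R : ℝ}
    {z : ℂ} (hp : 0 < p) (hδ : 0 < δ) (hR : ‖z‖ + δ ≤ R) (hR1 : R < 1) :
    ‖f z‖ₑ ^ p ≤ ENNReal.ofReal (4 / δ) * powMean p R f := by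
  have hR0 : 0 ≤ R := by linarith [norm_nonneg z]
  have hball : ball z δ ⊆ ball 0 1 := by
    intro w hw
    rw [mem_ball, dist_eq_norm] at hw
    have : ‖w‖ ≤ ‖z‖ + ‖w - z‖ := by simpa using norm_add_le z (w - z)
    rw [mem_ball_zero_iff]; linarith
  have h1 := enorm_rpow_mul_le_lintegral_ball hδ hp (hf.mono hball)
  set F : ℂ → ℝ≥0∞ := (ball z δ).indicator fun z => ‖f z‖ₑ ^ p with hFdef
  have hF : Measurable F := measurable_indicator_of_continuousOn measurableSet_ball
    (continuousOn_enorm_rpow (hf.mono hball).continuousOn p)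
  rw [← lintegral_indicator measurableSet_ball, ← hFdef,
    lintegral_eq_lintegral_circleLAverage hF] at h1
  -- the disc lies in the annulus `|x - |z|| < δ`, on which `x < R`
  have key : ∀ x ∈ Ioi (0 : ℝ),
      ENNReal.ofReal x * (ENNReal.ofReal (2 * Real.pi) * circleLAverage F 0 x) ≤
      (Ioo (‖z‖ - δ) (‖z‖ + δ)).indicator
        (fun _ => ENNReal.ofReal (2 * Real.pi) * powMean p R f) x := by
    intro x hx
    by_cases hxm : x ∈ Ioo (‖z‖ - δ) (‖z‖ + δ)
    · rw [indicator_of_mem hxm]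
      have hx1 : x < 1 := by linarith [hxm.2]
      have h2 : circleLAverage F 0 x ≤ powMean p x f := by
        rw [powMean, circleLAverage, circleLAverage]
        gcongr
        exact indicator_le_self _ _ _
      calc _ ≤ 1 * (ENNReal.ofReal (2 * Real.pi) * powMean p R f) := by
            gcongr
            · exact ENNReal.ofReal_le_one.2 hx1.le
            · exact h2.trans (powMean_monotoneOn hf hp ⟨(mem_Ioi.1 hx).le, hx1⟩ ⟨hR0, hR1⟩
                (by linarith [hxm.2]))
        _ = _ := one_mul _
    · have h3 : circleLAverage F 0 x = 0 := by
        have : ∀ θ, F (circleMap 0 x θ) = 0 := by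
          intro θ
          refine indicator_of_notMem (fun hm => hxm ?_) _
          rw [mem_ball, dist_eq_norm] at hm
          have h4 := (abs_norm_sub_norm_le (circleMap 0 x θ) z).trans_lt hm
          rw [norm_circleMap_zero, abs_of_pos (mem_Ioi.1 hx), abs_lt] at h4
          exact ⟨by linarith, by linarith⟩
        simp [circleLAverage, this]
      simp [h3]
  have h5 := h1.trans (setLIntegral_mono' measurableSet_Ioi key)
  have h6 := h5.trans (setLIntegral_le_lintegral _ _)
  rw [lintegral_indicator measurableSet_Ioo, setLIntegral_const, Real.volume_Ioo] at h6
  have hA : ENNReal.ofReal (Real.pi * δ ^ 2) ≠ 0 := by simp; positivity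
  calc ‖f z‖ₑ ^ p ≤ (ENNReal.ofReal (2 * Real.pi) * powMean p R f *
        ENNReal.ofReal (‖z‖ + δ - (‖z‖ - δ))) / ENNReal.ofReal (Real.pi * δ ^ 2) :=
        (ENNReal.le_div_iff_mul_le (Or.inl hA) (Or.inl ENNReal.ofReal_ne_top)).2 h6
    _ = ENNReal.ofReal (2 * Real.pi) * ENNReal.ofReal (2 * δ) / ENNReal.ofReal (Real.pi * δ ^ 2)
          * powMean p R f := by
        rw [show ‖z‖ + δ - (‖z‖ - δ) = 2 * δ by ring]
        simp only [div_eq_mul_inv]; ring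
    _ = _ := by
        rw [← ENNReal.ofReal_mul (by positivity), ← ENNReal.ofReal_div_of_pos (by positivity)]
        congr 2; field_simp; ring

/-- Local maximal inequality. The `p`-th power of the maximum of `|h|` over the rotation by `θ` of
a fixed disc `closedBall c a` is dominated by a function of `θ` whose average over the circle
is controlled by `M_p(R, h)^p`. -/
theorem exists_rotation_majorant {h : ℂ → ℂ} (hh : DifferentiableOn ℂ h (ball 0 1))
    {p c a δ R : ℝ} (hp : 0 < p) (hc : 0 ≤ c) (ha : 0 ≤ a) (hδ : 0 < δ) (hR : c + a + δ ≤ R)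
    (hR1 : R < 1) :
    ∃ G : ℝ → ℝ≥0∞,
      (∀ θ, ∀ w ∈ closedBall (c : ℂ) a, ‖h (w * circleMap 0 1 θ)‖ₑ ^ p ≤ G θ) ∧
      (∫⁻ θ in Ioc (0 : ℝ) (2 * Real.pi), G θ) / ENNReal.ofReal (2 * Real.pi) ≤
        ENNReal.ofReal (((a + δ) / δ) ^ 2) * powMean p R h := by
  have hA : ENNReal.ofReal (Real.pi * δ ^ 2) ≠ 0 := by simp; positivity
  have hball : ∀ w ∈ ball (c : ℂ) (a + δ), ‖w‖ < R := by
    intro w hw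
    rw [mem_ball, dist_eq_norm] at hw
    have h1 : ‖w‖ ≤ ‖(c : ℂ)‖ + ‖w - c‖ := by simpa using norm_add_le (c : ℂ) (w - c)
    rw [Complex.norm_real, Real.norm_eq_abs, abs_of_nonneg hc] at h1
    linarith
  have hrot : ∀ θ : ℝ, ∀ w ∈ ball (c : ℂ) (a + δ), w * circleMap 0 1 θ ∈ ball (0 : ℂ) 1 := by
    intro θ w hw
    have := hball w hw
    rw [mem_ball_zero_iff, norm_mul, norm_circleMap_zero, abs_one, mul_one]; linarith
  refine ⟨fun θ => (ENNReal.ofReal (Real.pi * δ ^ 2))⁻¹ *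
    ∫⁻ u in ball (c : ℂ) (a + δ), ‖h (u * circleMap 0 1 θ)‖ₑ ^ p, fun θ w hw => ?_, ?_⟩
  · have hsub : ball w δ ⊆ ball (c : ℂ) (a + δ) := by
      refine ball_subset_ball' ?_
      rw [mem_closedBall] at hw; linarith
    have h1 := enorm_rpow_mul_le_lintegral_ball (f := fun u => h (u * circleMap 0 1 θ)) (c := w)
      hδ hp (hh.comp (by fun_prop) fun u hu => hrot θ u (hsub hu))
    change _ ≤ (ENNReal.ofReal (Real.pi * δ ^ 2))⁻¹ * _
    rw [← ENNReal.div_eq_inv_mul]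
    exact (ENNReal.le_div_iff_mul_le (Or.inl hA) (Or.inl ENNReal.ofReal_ne_top)).2
      (h1.trans (lintegral_mono_set hsub))
  · have hmeas : AEMeasurable
        (Function.uncurry fun (θ : ℝ) (u : ℂ) => ‖h (u * circleMap 0 1 θ)‖ₑ ^ p)
        ((volume.restrict (Ioc (0 : ℝ) (2 * Real.pi))).prod
          (volume.restrict (ball (c : ℂ) (a + δ)))) := by
      rw [Measure.prod_restrict]
      refine ContinuousOn.aemeasurable ?_ (measurableSet_Ioc.prod measurableSet_ball)
      refine (continuousOn_enorm_rpow hh.continuousOn p).comp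
        (f := fun x : ℝ × ℂ => x.2 * circleMap 0 1 x.1) ?_ fun x hx => hrot _ _ hx.2
      fun_prop
    rw [lintegral_const_mul' _ _ (ENNReal.inv_ne_top.2 hA), lintegral_lintegral_swap hmeas]
    have h2 : ∫⁻ u in ball (c : ℂ) (a + δ), ∫⁻ θ in Ioc (0 : ℝ) (2 * Real.pi),
        ‖h (u * circleMap 0 1 θ)‖ₑ ^ p ≤
        ∫⁻ _ in ball (c : ℂ) (a + δ), ENNReal.ofReal (2 * Real.pi) * powMean p R h := by
      refine setLIntegral_mono' measurableSet_ball fun u hu => ?_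
      rw [lintegral_mul_circleMap (fun z => ‖h z‖ₑ ^ p) u]
      gcongr
      exact powMean_monotoneOn hh hp ⟨norm_nonneg u, (hball u hu).trans hR1⟩
        ⟨(norm_nonneg u).trans (hball u hu).le, hR1⟩ (hball u hu).le
    have hvol : volume (ball (c : ℂ) (a + δ)) = ENNReal.ofReal (Real.pi * (a + δ) ^ 2) := by
      rw [Complex.volume_ball, mul_comm, ENNReal.ofReal_mul Real.pi_pos.le,
        ENNReal.ofReal_pow (by positivity)]
      congr 1
      rw [← NNReal.coe_real_pi, ENNReal.ofReal_coe_nnreal]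
    rw [setLIntegral_const, hvol] at h2
    calc _ ≤ (ENNReal.ofReal (Real.pi * δ ^ 2))⁻¹ * (ENNReal.ofReal (2 * Real.pi) * powMean p R h *
          ENNReal.ofReal (Real.pi * (a + δ) ^ 2)) / ENNReal.ofReal (2 * Real.pi) := by gcongr
      _ = (ENNReal.ofReal (2 * Real.pi) / ENNReal.ofReal (2 * Real.pi)) *
          (ENNReal.ofReal (Real.pi * (a + δ) ^ 2) / ENNReal.ofReal (Real.pi * δ ^ 2)) *
          powMean p R h := by simp only [div_eq_mul_inv]; ring
      _ = _ := by
        rw [ENNReal.div_self ofReal_two_pi_pos ENNReal.ofReal_ne_top, one_mul,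
          ← ENNReal.ofReal_div_of_pos (by positivity)]
        congr 2; field_simp

/-! ### Comparison of integral means on different circles -/

theorem circleMap_zero_eq_mul (r θ : ℝ) : circleMap 0 r θ = r * circleMap 0 1 θ := by
  simp [circleMap]

theorem circleMap_zero_mem_unitBall {r : ℝ} (hr : r ∈ Ico (0 : ℝ) 1) (θ : ℝ) :
    circleMap 0 r θ ∈ ball (0 : ℂ) 1 := by
  simp [abs_of_nonneg hr.1, hr.2]

/-- `M_p(r, f)^p` is bounded by the circle average of any pointwise majorant. -/
theorem powMean_le_of_forall {p r : ℝ} {f : ℂ → ℂ} {G : ℝ → ℝ≥0∞}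
    (h : ∀ θ, ‖f (circleMap 0 r θ)‖ₑ ^ p ≤ G θ) :
    powMean p r f ≤
      (∫⁻ θ in Ioc (0 : ℝ) (2 * Real.pi), G θ) / ENNReal.ofReal (2 * Real.pi) := by
  rw [powMean, circleLAverage]
  gcongr
  exact h _

theorem lintegral_enorm_rpow_circleMap (p r : ℝ) (f : ℂ → ℂ) :
    ∫⁻ θ in Ioc (0 : ℝ) (2 * Real.pi), ‖f (circleMap 0 r θ)‖ₑ ^ p
      = ENNReal.ofReal (2 * Real.pi) * powMean p r f :=
  lintegral_circleMap_eq (fun z => ‖f z‖ₑ ^ p) 0 r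

theorem ofReal_two_pi_mul_div (x : ℝ≥0∞) :
    ENNReal.ofReal (2 * Real.pi) * x / ENNReal.ofReal (2 * Real.pi) = x := by
  rw [mul_comm, mul_div_assoc, ENNReal.div_self ofReal_two_pi_pos ENNReal.ofReal_ne_top, mul_one]

theorem measurable_enorm_rpow_circleMap {f : ℂ → ℂ} (hf : ContinuousOn f (ball 0 1)) {r : ℝ}
    (hr : r ∈ Ico (0 : ℝ) 1) (p : ℝ) :
    Measurable fun θ : ℝ => ‖f (circleMap 0 r θ)‖ₑ ^ p :=
  ((continuousOn_enorm_rpow hf p).comp_continuous (by fun_prop)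
    (circleMap_zero_mem_unitBall hr)).measurable

/-- Increasing the exponent of an integral mean from `p` to `s` costs the power `1/p - 1/s` of the
distance between the radii. -/
theorem mean_le_mean_of_le {f : ℂ → ℂ} (hf : DifferentiableOn ℂ f (ball 0 1)) {p s r δ R : ℝ}
    (hp : 0 < p) (hps : p ≤ s) (hr : 0 ≤ r) (hδ : 0 < δ) (hR : r + δ ≤ R) (hR1 : R < 1) :
    mean (ENNReal.ofReal s) r f ≤
      ENNReal.ofReal ((4 / δ) ^ (1 / p - 1 / s)) * mean (ENNReal.ofReal p) R f := by
  have hs : 0 < s := hp.trans_le hps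
  have hr' : r ∈ Ico (0 : ℝ) 1 := ⟨hr, by linarith⟩
  have hR' : R ∈ Ico (0 : ℝ) 1 := ⟨by linarith, hR1⟩
  have he : 0 ≤ (s - p) / p := div_nonneg (sub_nonneg.2 hps) hp.le
  rw [mean_ofReal hs, mean_ofReal hp]
  set P := powMean p R f
  set c := ENNReal.ofReal (4 / δ) with hc
  have h1 : powMean s r f ≤ (c * P) ^ ((s - p) / p) * P := by
    have h2 : ∀ θ, ‖f (circleMap 0 r θ)‖ₑ ^ s
        ≤ (c * P) ^ ((s - p) / p) * ‖f (circleMap 0 r θ)‖ₑ ^ p := by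
      intro θ
      have h3 : ‖f (circleMap 0 r θ)‖ₑ ^ p ≤ c * P := by
        refine enorm_rpow_le_powMean hf hp hδ ?_ hR1
        rwa [norm_circleMap_zero, abs_of_nonneg hr]
      calc ‖f (circleMap 0 r θ)‖ₑ ^ s
          = (‖f (circleMap 0 r θ)‖ₑ ^ p) ^ ((s - p) / p) * ‖f (circleMap 0 r θ)‖ₑ ^ p := by
            rw [← ENNReal.rpow_mul, ← ENNReal.rpow_add_of_nonneg _ _ (mul_nonneg hp.le he) hp.le]
            congr 1; field_simp; ring
        _ ≤ _ := by gcongr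
    refine (powMean_le_of_forall h2).trans ?_
    rw [lintegral_const_mul _ (measurable_enorm_rpow_circleMap hf.continuousOn hr' p),
      lintegral_enorm_rpow_circleMap, mul_left_comm, ofReal_two_pi_mul_div]
    gcongr
    exact powMean_monotoneOn hf hp hr' hR' (by linarith)
  calc powMean s r f ^ (1 / s) ≤ ((c * P) ^ ((s - p) / p) * P) ^ (1 / s) := by gcongr
    _ = c ^ (1 / p - 1 / s) * P ^ (1 / p) := by
      have h4 : P ^ ((s - p) / p) * P = P ^ ((s - p) / p + 1) := by
        rw [ENNReal.rpow_add_of_nonneg _ _ he zero_le_one, ENNReal.rpow_one]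
      rw [ENNReal.mul_rpow_of_nonneg _ _ he, mul_assoc, h4,
        ENNReal.mul_rpow_of_nonneg _ _ (by positivity), ← ENNReal.rpow_mul, ← ENNReal.rpow_mul]
      congr 2 <;> field_simp
      ring
    _ = _ := by rw [hc, ENNReal.ofReal_rpow_of_pos (by positivity)]

theorem mem_closedBall_mul_circleMap {r θ a : ℝ} {v : ℂ}
    (hv : v ∈ closedBall (circleMap 0 r θ) a) :
    ∃ w ∈ closedBall (r : ℂ) a, v = w * circleMap 0 1 θ := by
  have h1 : ‖circleMap 0 1 θ‖ = 1 := by simp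
  have h0 : circleMap 0 1 θ ≠ 0 := by rw [← norm_ne_zero_iff, h1]; exact one_ne_zero
  refine ⟨v / circleMap 0 1 θ, ?_, by field_simp⟩
  have h2 : v / circleMap 0 1 θ - r = (v - circleMap 0 r θ) / circleMap 0 1 θ := by
    rw [circleMap_zero_eq_mul r θ]; field_simp
  rw [mem_closedBall, dist_eq_norm] at hv ⊢
  rwa [h2, norm_div, h1, div_one]

theorem closedBall_circleMap_subset {r θ a : ℝ} (hr : 0 ≤ r) (ha : r + a < 1) :
    closedBall (circleMap 0 r θ) a ⊆ ball 0 1 := by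
  intro v hv
  rw [mem_closedBall, dist_eq_norm] at hv
  have : ‖v‖ ≤ ‖circleMap 0 r θ‖ + ‖v - circleMap 0 r θ‖ := by
    simpa using norm_add_le (circleMap 0 r θ) (v - circleMap 0 r θ)
  rw [norm_circleMap_zero, abs_of_nonneg hr] at this
  rw [mem_ball_zero_iff]; linarith

/-- Integral means of the derivative: Cauchy's estimate bounds `|g'|` by the maximum of `|g|` over a
disc, and the local maximal inequality controls that maximum. -/
theorem mean_deriv_le {g : ℂ → ℂ} (hg : DifferentiableOn ℂ g (ball 0 1)) {p r δ R : ℝ}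
    (hp : 0 < p) (hr : 0 ≤ r) (hδ : 0 < δ) (hR : r + 2 * δ ≤ R) (hR1 : R < 1) :
    mean (ENNReal.ofReal p) r (deriv g) ≤
      ENNReal.ofReal (4 ^ (1 / p) / δ) * mean (ENNReal.ofReal p) R g := by
  obtain ⟨G, hG, hGi⟩ := exists_rotation_majorant hg hp hr hδ.le hδ (by linarith) hR1
  have h1 : ∀ θ, ‖deriv g (circleMap 0 r θ)‖ₑ ^ p ≤ (ENNReal.ofReal (1 / δ)) ^ p * G θ := by
    intro θ
    have hsub := closedBall_circleMap_subset (r := r) (θ := θ) (a := δ) hr (by linarith)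
    obtain ⟨v, hv, hmax⟩ := (isCompact_closedBall (circleMap 0 r θ) δ).exists_isMaxOn
      (nonempty_closedBall.2 hδ.le) (hg.continuousOn.mono hsub).norm
    have h2 : ‖deriv g (circleMap 0 r θ)‖ ≤ ‖g v‖ / δ := by
      refine Complex.norm_deriv_le_of_forall_mem_sphere_norm_le hδ ?_
        fun z hz => hmax (sphere_subset_closedBall hz)
      refine DifferentiableOn.diffContOnCl ?_
      rw [closure_ball _ hδ.ne']
      exact hg.mono hsub
    obtain ⟨w, hw, rfl⟩ := mem_closedBall_mul_circleMap hv
    have h3 : ‖deriv g (circleMap 0 r θ)‖ₑ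
        ≤ ENNReal.ofReal (1 / δ) * ‖g (w * circleMap 0 1 θ)‖ₑ := by
      rw [← ofReal_norm, ← ofReal_norm, ← ENNReal.ofReal_mul (by positivity)]
      refine ENNReal.ofReal_le_ofReal (h2.trans (le_of_eq (by ring)))
    calc _ ≤ (ENNReal.ofReal (1 / δ) * ‖g (w * circleMap 0 1 θ)‖ₑ) ^ p := by gcongr
      _ = (ENNReal.ofReal (1 / δ)) ^ p * ‖g (w * circleMap 0 1 θ)‖ₑ ^ p :=
        ENNReal.mul_rpow_of_nonneg _ _ hp.le
      _ ≤ _ := by gcongr; exact hG θ w hw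
  have h4 := powMean_le_of_forall h1
  rw [lintegral_const_mul' _ _ (by finiteness), mul_div_assoc] at h4
  have h5 : powMean p r (deriv g) ≤
      ENNReal.ofReal (1 / δ) ^ p * (ENNReal.ofReal (((δ + δ) / δ) ^ 2) * powMean p R g) :=
    h4.trans (by gcongr)
  rw [mean_ofReal hp, mean_ofReal hp]
  calc _ ≤ (ENNReal.ofReal (1 / δ) ^ p *
        (ENNReal.ofReal (((δ + δ) / δ) ^ 2) * powMean p R g)) ^ (1 / p) := by gcongr
    _ = _ := by
      rw [ENNReal.mul_rpow_of_nonneg _ _ (by positivity),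
        ENNReal.mul_rpow_of_nonneg _ _ (by positivity), ← ENNReal.rpow_mul,
        mul_one_div_cancel hp.ne', ENNReal.rpow_one, ← mul_assoc,
        ENNReal.ofReal_rpow_of_nonneg (by positivity) (by positivity),
        ← ENNReal.ofReal_mul (by positivity), show ((δ + δ) / δ) ^ 2 = 4 by field_simp; norm_num]
      congr 2; ring

/-- A quasi-triangle inequality for powers whose first constant is arbitrarily close to `1`. -/
theorem exists_add_rpow_le {s η : ℝ} (hs : 0 < s) (hη : 1 < η) :
    ∃ C : ℝ≥0∞, C ≠ ∞ ∧ ∀ x y : ℝ≥0∞, (x + y) ^ s ≤ ENNReal.ofReal η * x ^ s + C * y ^ s := by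
  -- `(1 + l) ^ s = η`; the two terms compete according to whether `y ≤ l * x`
  set l : ℝ := η ^ (1 / s) - 1 with hl
  have hl0 : 0 < l := sub_pos.2 (Real.one_lt_rpow hη (by positivity))
  refine ⟨ENNReal.ofReal ((1 / l + 1) ^ s), ENNReal.ofReal_ne_top, fun x y => ?_⟩
  rcases le_total y (ENNReal.ofReal l * x) with h | h
  · refine le_add_right ?_
    calc (x + y) ^ s ≤ (ENNReal.ofReal (1 + l) * x) ^ s := by
          gcongr
          rw [ENNReal.ofReal_add zero_le_one hl0.le, add_mul, ENNReal.ofReal_one, one_mul]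
          gcongr
      _ = _ := by
          rw [ENNReal.mul_rpow_of_nonneg _ _ hs.le,
            ENNReal.ofReal_rpow_of_pos (by positivity), hl, add_sub_cancel,
            ← Real.rpow_mul (by positivity), one_div_mul_cancel hs.ne', Real.rpow_one]
  · refine le_add_left ?_
    have hx : x ≤ ENNReal.ofReal (1 / l) * y := by
      calc x = ENNReal.ofReal (1 / l) * (ENNReal.ofReal l * x) := by
            rw [← mul_assoc, ← ENNReal.ofReal_mul (by positivity), one_div_mul_cancel hl0.ne',
              ENNReal.ofReal_one, one_mul]
        _ ≤ _ := by gcongr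
    calc (x + y) ^ s ≤ (ENNReal.ofReal (1 / l + 1) * y) ^ s := by
          gcongr
          rw [ENNReal.ofReal_add (by positivity) zero_le_one, add_mul, ENNReal.ofReal_one, one_mul]
          gcongr
      _ = _ := by
          rw [ENNReal.mul_rpow_of_nonneg _ _ hs.le, ENNReal.ofReal_rpow_of_pos (by positivity)]

/-- One step of the Littlewood–Paley estimate: passing from radius `r` to `r'` costs a factor close
to `1` and a term controlled by the integral mean of the derivative on a slightly larger
circle. The increment of `F` along a ray is bounded by the maximum of `|F'|` over a disc, so the
argument covers all `s > 0`, including `s < 1`. -/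
theorem exists_mean_rpow_le_add {s t η κ : ℝ} (hs : 0 < s) (ht : 0 < t) (hη : 1 < η) :
    ∃ C : ℝ≥0∞, C ≠ ∞ ∧ ∀ F : ℂ → ℂ, DifferentiableOn ℂ F (ball 0 1) → ∀ r r' δ R : ℝ,
      0 ≤ r → r ≤ r' → 0 < δ → r' - r ≤ κ * δ → r' + δ ≤ R → R < 1 →
      mean (ENNReal.ofReal s) r' F ^ t ≤ ENNReal.ofReal η * mean (ENNReal.ofReal s) r F ^ t
        + C * (ENNReal.ofReal (r' - r) * mean (ENNReal.ofReal s) R (deriv F)) ^ t := by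
  have hη0 : 0 < η := by linarith
  -- The inequality is applied first to the exponent `s`, pointwise, then to the exponent `t / s`,
  -- on the means; the constants are chosen so that `η₂ * η₁ ^ (t / s) = η`.
  set η₁ := η ^ (s / (2 * t)) with hη₁
  set η₂ := η ^ (1 / 2 : ℝ) with hη₂
  obtain ⟨C₁, hC₁, h₁⟩ := exists_add_rpow_le hs (Real.one_lt_rpow hη (by positivity) : 1 < η₁)
  obtain ⟨C₂, hC₂, h₂⟩ := exists_add_rpow_le (s := t / s) (by positivity)
    (Real.one_lt_rpow hη (by norm_num) : 1 < η₂)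
  have hts : 0 ≤ t / s := by positivity
  refine ⟨C₂ * (C₁ * ENNReal.ofReal ((κ + 1) ^ 2)) ^ (t / s), by finiteness, ?_⟩
  intro F hF r r' δ R hr hrr' hδ hκ hR hR1
  have hr1 : r ∈ Ico (0 : ℝ) 1 := ⟨hr, by linarith⟩
  have hF' : DifferentiableOn ℂ (deriv F) (ball 0 1) := hF.deriv isOpen_ball
  obtain ⟨G, hG, hGi⟩ := exists_rotation_majorant hF' hs hr (sub_nonneg.2 hrr') hδ
    (by linarith) hR1
  set d := ENNReal.ofReal (r' - r)
  have hpt : ∀ θ, ‖F (circleMap 0 r' θ)‖ₑ ^ s ≤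
      ENNReal.ofReal η₁ * ‖F (circleMap 0 r θ)‖ₑ ^ s + (C₁ * d ^ s) * G θ := by
    intro θ
    have hsub := closedBall_circleMap_subset (r := r) (θ := θ) (a := r' - r) hr (by linarith)
    obtain ⟨v, hv, hmax⟩ := (isCompact_closedBall (circleMap 0 r θ) (r' - r)).exists_isMaxOn
      (nonempty_closedBall.2 (sub_nonneg.2 hrr')) (hF'.continuousOn.mono hsub).norm
    have hdist : ‖circleMap 0 r' θ - circleMap 0 r θ‖ = r' - r := by
      rw [circleMap_zero_eq_mul r', circleMap_zero_eq_mul r, ← sub_mul, norm_mul,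
        norm_circleMap_zero, abs_one, mul_one, ← Complex.ofReal_sub, Complex.norm_real,
        Real.norm_eq_abs, abs_of_nonneg (sub_nonneg.2 hrr')]
    have hmv : ‖F (circleMap 0 r' θ) - F (circleMap 0 r θ)‖ ≤ ‖deriv F v‖ * (r' - r) := by
      have := (convex_closedBall (circleMap 0 r θ) (r' - r)).norm_image_sub_le_of_norm_deriv_le
        (f := F) (C := ‖deriv F v‖)
        (fun x hx => hF.differentiableAt (isOpen_ball.mem_nhds (hsub hx)))
        (fun x hx => hmax hx) (mem_closedBall_self (sub_nonneg.2 hrr'))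
        (y := circleMap 0 r' θ) (by rw [mem_closedBall, dist_eq_norm, hdist])
      rwa [hdist] at this
    obtain ⟨w, hw, rfl⟩ := mem_closedBall_mul_circleMap hv
    have h3 : ‖F (circleMap 0 r' θ)‖ₑ
        ≤ ‖F (circleMap 0 r θ)‖ₑ + d * ‖deriv F (w * circleMap 0 1 θ)‖ₑ := by
      have h4 : ‖F (circleMap 0 r' θ)‖ ≤ ‖F (circleMap 0 r θ)‖
          + (r' - r) * ‖deriv F (w * circleMap 0 1 θ)‖ := by
        have := norm_add_le (F (circleMap 0 r θ)) (F (circleMap 0 r' θ) - F (circleMap 0 r θ))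
        rw [add_sub_cancel] at this
        linarith
      have h5 := ENNReal.ofReal_le_ofReal h4
      rwa [ENNReal.ofReal_add (norm_nonneg _)
        (mul_nonneg (sub_nonneg.2 hrr') (norm_nonneg _)),
        ENNReal.ofReal_mul (sub_nonneg.2 hrr'), ofReal_norm, ofReal_norm, ofReal_norm] at h5
    calc _ ≤ (‖F (circleMap 0 r θ)‖ₑ + d * ‖deriv F (w * circleMap 0 1 θ)‖ₑ) ^ s := by gcongr
      _ ≤ _ := h₁ _ _
      _ = ENNReal.ofReal η₁ * ‖F (circleMap 0 r θ)‖ₑ ^ s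
          + (C₁ * d ^ s) * ‖deriv F (w * circleMap 0 1 θ)‖ₑ ^ s := by
        rw [ENNReal.mul_rpow_of_nonneg _ _ hs.le, mul_assoc]
      _ ≤ _ := by gcongr; exact hG θ w hw
  have hpow : powMean s r' F ≤ ENNReal.ofReal η₁ * powMean s r F
      + C₁ * ENNReal.ofReal ((κ + 1) ^ 2) * (d ^ s * powMean s R (deriv F)) := by
    refine (powMean_le_of_forall hpt).trans ?_
    have hm := measurable_enorm_rpow_circleMap hF.continuousOn hr1 s
    rw [lintegral_add_left (hm.const_mul _), lintegral_const_mul _ hm,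
      lintegral_const_mul' _ _ (by finiteness), lintegral_enorm_rpow_circleMap, ENNReal.add_div,
      mul_left_comm, ofReal_two_pi_mul_div, mul_div_assoc]
    refine add_le_add le_rfl ?_
    calc _ ≤ C₁ * d ^ s * (ENNReal.ofReal ((((r' - r) + δ) / δ) ^ 2) * powMean s R (deriv F)) := by
          gcongr
      _ ≤ C₁ * d ^ s * (ENNReal.ofReal ((κ + 1) ^ 2) * powMean s R (deriv F)) := by
          gcongr
          have : 0 ≤ r' - r := sub_nonneg.2 hrr'
          have h6 : ((r' - r) + δ) / δ ≤ κ + 1 := by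
            rw [div_le_iff₀ hδ]; linarith
          gcongr
      _ = _ := by ring
  have hrw : ∀ (ρ : ℝ) (h : ℂ → ℂ), mean (ENNReal.ofReal s) ρ h ^ t = powMean s ρ h ^ (t / s) := by
    intro ρ h
    rw [mean_ofReal hs, ← ENNReal.rpow_mul]; congr 1; ring
  rw [ENNReal.mul_rpow_of_nonneg _ _ ht.le, hrw, hrw, hrw]
  calc _ ≤ (ENNReal.ofReal η₁ * powMean s r F
      + C₁ * ENNReal.ofReal ((κ + 1) ^ 2) * (d ^ s * powMean s R (deriv F))) ^ (t / s) := by gcongr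
    _ ≤ _ := h₂ _ _
    _ = _ := by
      have hη' : ENNReal.ofReal η₂ * ENNReal.ofReal η₁ ^ (t / s) = ENNReal.ofReal η := by
        rw [ENNReal.ofReal_rpow_of_pos (by positivity), ← ENNReal.ofReal_mul (by positivity),
          hη₁, hη₂, ← Real.rpow_mul hη0.le, ← Real.rpow_add hη0]
        have : 1 / 2 + s / (2 * t) * (t / s) = 1 := by field_simp; norm_num
        rw [this, Real.rpow_one]
      have hd' : (d ^ s) ^ (t / s) = d ^ t := by
        rw [← ENNReal.rpow_mul d, mul_div_cancel₀ _ hs.ne']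
      simp only [ENNReal.mul_rpow_of_nonneg _ _ hts]
      rw [← mul_assoc (ENNReal.ofReal η₂), hη', hd']
      ring

/-- The maximum modulus principle in terms of `M_∞`. -/
theorem mean_top_monotoneOn {g : ℂ → ℂ} (hg : DifferentiableOn ℂ g (ball 0 1)) :
    MonotoneOn (fun r => mean ∞ r g) (Ico 0 1) := by
  intro r hr R hR hrR
  simp only [mean, if_true]
  refine iSup₂_le fun z hz => ?_
  rcases hrR.eq_or_lt with rfl | hlt
  · exact le_iSup₂ (f := fun z (_ : z ∈ sphere (0 : ℂ) r) => ‖g z‖ₑ) z hz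
  have hR0 : 0 < R := hr.1.trans_lt hlt
  have hd : DiffContOnCl ℂ g (ball 0 R) := by
    refine DifferentiableOn.diffContOnCl ?_
    rw [closure_ball _ hR0.ne']
    exact hg.mono (closedBall_subset_ball hR.2)
  obtain ⟨w, hw, hmax⟩ := Complex.exists_mem_frontier_isMaxOn_norm isBounded_ball
    (nonempty_ball.2 hR0) hd
  rw [frontier_ball _ hR0.ne'] at hw
  have hz' : z ∈ closure (ball (0 : ℂ) R) := by
    refine subset_closure ?_
    rw [mem_sphere_zero_iff_norm] at hz
    rw [mem_ball_zero_iff, hz]; exact hlt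
  calc ‖g z‖ₑ ≤ ‖g w‖ₑ := by
        rw [← ofReal_norm, ← ofReal_norm]; exact ENNReal.ofReal_le_ofReal (hmax hz')
    _ ≤ _ := le_iSup₂ (f := fun z (_ : z ∈ sphere (0 : ℂ) R) => ‖g z‖ₑ) w hw

theorem mean_ofReal_monotoneOn {f : ℂ → ℂ} (hf : DifferentiableOn ℂ f (ball 0 1)) {p : ℝ}
    (hp : 0 < p) : MonotoneOn (fun r => mean (ENNReal.ofReal p) r f) (Ico 0 1) := by
  intro r hr R hR hrR
  simp only [mean_ofReal hp]
  gcongr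
  exact powMean_monotoneOn hf hp hr hR hrR

/-! ### Sums of sequences -/

theorem le_mul_of_le_mul_add {x y : ℝ≥0∞} {b : ℝ} (hx : x ≠ ∞) (hb0 : 0 ≤ b) (hb : b < 1)
    (h : x ≤ ENNReal.ofReal b * x + y) : x ≤ ENNReal.ofReal (1 / (1 - b)) * y := by
  have hb1 : 0 < 1 - b := by linarith
  have h1 : ENNReal.ofReal (1 - b) * x + ENNReal.ofReal b * x = x := by
    rw [← add_mul, ← ENNReal.ofReal_add hb1.le hb0]; simp
  have h2 : ENNReal.ofReal (1 - b) * x ≤ y := by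
    rw [← ENNReal.add_le_add_iff_left (a := ENNReal.ofReal b * x) (by finiteness)]
    rwa [add_comm, h1]
  calc x = ENNReal.ofReal (1 / (1 - b)) * (ENNReal.ofReal (1 - b) * x) := by
        rw [← mul_assoc, ← ENNReal.ofReal_mul (by positivity), one_div_mul_cancel hb1.ne',
          ENNReal.ofReal_one, one_mul]
    _ ≤ _ := by gcongr

/-- A discrete Hardy inequality: the contraction factor `b < 1` is absorbed in the partial sums,
which are finite. -/
theorem tsum_le_of_le_mul_add {x y : ℕ → ℝ≥0∞} {b : ℝ} (h0 : x 0 = 0) (hx : ∀ n, x n ≠ ∞)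
    (hb0 : 0 ≤ b) (hb : b < 1) (h : ∀ n, x (n + 1) ≤ ENNReal.ofReal b * x n + y n) :
    ∑' n, x (n + 1) ≤ ENNReal.ofReal (1 / (1 - b)) * ∑' n, y n := by
  refine ENNReal.tsum_le_of_sum_range_le fun N => ?_
  refine le_mul_of_le_mul_add (ENNReal.sum_ne_top.2 fun n _ => hx _) hb0 hb ?_
  calc ∑ n ∈ Finset.range N, x (n + 1)
      ≤ ∑ n ∈ Finset.range N, (ENNReal.ofReal b * x n + y n) := Finset.sum_le_sum fun n _ => h n
    _ = ENNReal.ofReal b * ∑ n ∈ Finset.range N, x n + ∑ n ∈ Finset.range N, y n := by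
      rw [Finset.sum_add_distrib, Finset.mul_sum]
    _ ≤ _ := by
      have hshift : ∑ n ∈ Finset.range N, x n ≤ ∑ n ∈ Finset.range N, x (n + 1) :=
        calc _ ≤ ∑ n ∈ Finset.range (N + 1), x n :=
              Finset.sum_le_sum_of_subset (Finset.range_mono (Nat.le_succ N))
          _ = _ := by rw [Finset.sum_range_succ', h0, add_zero]
      exact add_le_add (mul_le_mul_right hshift _) (ENNReal.sum_le_tsum _)

theorem tsum_rpow_le_rpow_tsum {x : ℕ → ℝ≥0∞} {r : ℝ} (hr : 1 ≤ r) :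
    ∑' n, x n ^ r ≤ (∑' n, x n) ^ r := by
  refine ENNReal.tsum_le_of_sum_range_le fun N => ?_
  refine le_trans ?_ (ENNReal.rpow_le_rpow (ENNReal.sum_le_tsum (Finset.range N)) (by linarith))
  have hr0 : 0 ≤ r - 1 := by linarith
  have hsplit : ∀ y : ℝ≥0∞, y ^ r = y ^ (r - 1) * y := fun y => by
    conv_rhs => rw [← ENNReal.rpow_one y, ← ENNReal.rpow_mul]
    rw [← ENNReal.rpow_add_of_nonneg _ _ (by linarith) zero_le_one]; congr 1; ring
  rw [hsplit (∑ n ∈ Finset.range N, x n), Finset.mul_sum]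
  refine Finset.sum_le_sum fun n hn => ?_
  rw [hsplit (x n)]
  gcongr
  exact Finset.single_le_sum (fun i _ => zero_le) hn

/-- The quantity that controls multiplication by the sequence `b` from `ℓ^q` to `ℓ^t`, both with the
weight `w`: the supremum of `b w^(1/q̃)` if `q ≤ t`, the weighted `ℓ^q̃` norm of `b` if `t < q`. -/
def multiplierNorm (w : ℕ → ℝ≥0∞) (q t : ℝ) (b : ℕ → ℝ≥0∞) : ℝ≥0∞ :=
  if q ≤ t then ⨆ n, b n * w n ^ invTilde q t
  else (∑' n, b n ^ tilde q t * w n) ^ (1 / tilde q t)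

/-- For `q ≤ t` this is the inclusion of `ℓ^q` in `ℓ^t`, for `t < q` Hölder's inequality. -/
theorem tsum_mul_rpow_le {w : ℕ → ℝ≥0∞} (hw0 : ∀ n, w n ≠ 0) (hw : ∀ n, w n ≠ ∞) {q t : ℝ}
    (hq : 0 < q) (ht : 0 < t) (a b : ℕ → ℝ≥0∞) :
    ∑' n, (a n * b n) ^ t * w n ≤
      (multiplierNorm w q t b * (∑' n, a n ^ q * w n) ^ (1 / q)) ^ t := by
  by_cases hqt : q ≤ t
  · rw [multiplierNorm, if_pos hqt]
    set B := ⨆ n, b n * w n ^ invTilde q t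
    have htq : 1 ≤ t / q := (one_le_div hq).2 hqt
    calc ∑' n, (a n * b n) ^ t * w n ≤ ∑' n, B ^ t * (a n ^ q * w n) ^ (t / q) := by
          refine ENNReal.tsum_le_tsum fun n => ?_
          calc (a n * b n) ^ t * w n
              = (b n * w n ^ invTilde q t) ^ t * (a n ^ q * w n) ^ (t / q) := by
                rw [ENNReal.mul_rpow_of_nonneg _ _ ht.le, ENNReal.mul_rpow_of_nonneg _ _ ht.le,
                  ENNReal.mul_rpow_of_nonneg _ _ (by positivity), ← ENNReal.rpow_mul,
                  ← ENNReal.rpow_mul, mul_div_cancel₀ _ hq.ne']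
                have : w n = w n ^ (invTilde q t * t) * w n ^ (t / q) := by
                  rw [← ENNReal.rpow_add _ _ (hw0 n) (hw n)]
                  have : invTilde q t * t + t / q = 1 := by rw [invTilde]; field_simp; ring
                  rw [this, ENNReal.rpow_one]
                nth_rw 1 [this]
                ring
            _ ≤ _ := by
              gcongr
              exact le_iSup (fun n => b n * w n ^ invTilde q t) n
      _ = B ^ t * ∑' n, (a n ^ q * w n) ^ (t / q) := ENNReal.tsum_mul_left
      _ ≤ B ^ t * (∑' n, a n ^ q * w n) ^ (t / q) := by
          gcongr; exact tsum_rpow_le_rpow_tsum htq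
      _ = _ := by
          rw [ENNReal.mul_rpow_of_nonneg _ _ ht.le, ← ENNReal.rpow_mul]
          congr 2; ring
  · rw [multiplierNorm, if_neg hqt]
    push Not at hqt
    have hinv : 0 < invTilde q t := sub_pos.2 (one_div_lt_one_div_of_lt ht hqt)
    have htil : 0 < tilde q t := inv_pos.2 hinv
    have hconj : (q / t).HolderConjugate (tilde q t / t) := by
      refine Real.holderConjugate_iff.2 ⟨(one_lt_div ht).2 hqt, ?_⟩
      rw [tilde, inv_div, inv_div, div_inv_eq_mul, invTilde]; field_simp; ring
    refine ENNReal.tsum_le_of_sum_range_le fun N => ?_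
    have hsum : t / q + t / tilde q t = 1 := by
      rw [tilde, div_inv_eq_mul, invTilde]; field_simp; ring
    have h1 := ENNReal.inner_le_Lp_mul_Lq (Finset.range N) (fun n => a n ^ t * w n ^ (t / q))
      (fun n => b n ^ t * w n ^ (t / tilde q t)) hconj
    have h2 : ∀ n, a n ^ t * w n ^ (t / q) * (b n ^ t * w n ^ (t / tilde q t))
        = (a n * b n) ^ t * w n := by
      intro n
      rw [ENNReal.mul_rpow_of_nonneg _ _ ht.le]
      have : w n = w n ^ (t / q) * w n ^ (t / tilde q t) := by
        rw [← ENNReal.rpow_add _ _ (hw0 n) (hw n), hsum, ENNReal.rpow_one]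
      nth_rw 3 [this]
      ring
    have h3 : ∀ (r : ℝ), 0 < r → ∀ x y : ℝ≥0∞, (x ^ t * y ^ (t / r)) ^ (r / t) = x ^ r * y := by
      intro r hr x y
      rw [ENNReal.mul_rpow_of_nonneg _ _ (by positivity), ← ENNReal.rpow_mul, ← ENNReal.rpow_mul,
        mul_div_cancel₀ _ ht.ne', div_mul_div_cancel₀ hr.ne', div_self ht.ne', ENNReal.rpow_one]
    simp only [h2, h3 q hq, h3 _ htil] at h1
    refine h1.trans ?_
    rw [ENNReal.mul_rpow_of_nonneg _ _ ht.le, ← ENNReal.rpow_mul, ← ENNReal.rpow_mul, mul_comm]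
    have e1 : 1 / tilde q t * t = 1 / (tilde q t / t) := by field_simp
    have e2 : 1 / q * t = 1 / (q / t) := by field_simp
    rw [e1, e2]
    gcongr <;> exact ENNReal.sum_le_tsum _

/-! ### Doubling weights along a geometric grid of radii -/

/-- The radii `1 - K^{-n}`. -/
def gridRadius (K : ℝ) (n : ℕ) : ℝ := 1 - (K ^ n)⁻¹

/-- The tail integrals of `ω` at the radii `1 - K^{-n}`. -/
def gridTail (ω : ℝ → ℝ) (K : ℝ) (n : ℕ) : ℝ≥0∞ := ENNReal.ofReal (tail ω (gridRadius K n))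

/-- Along the radii `1 - K^{-n}` the tail integrals of `ω` decay geometrically: the ratio of
consecutive ones is between `D⁻¹` and `τ < 1`. -/
structure IsGrid (ω : ℝ → ℝ) (K τ D : ℝ) : Prop where
  weight : IsRadialWeight ω
  two_le : 2 ≤ K
  pos : 0 < τ
  lt_one : τ < 1
  succ_le : ∀ n, tail ω (gridRadius K (n + 1)) ≤ τ * tail ω (gridRadius K n)
  le_succ : ∀ n, tail ω (gridRadius K n) ≤ D * tail ω (gridRadius K (n + 1))

theorem tail_antitoneOn {ω : ℝ → ℝ} (hω : IsRadialWeight ω) : AntitoneOn (tail ω) (Ico 0 1) := by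
  intro r hr R _ hrR
  refine setIntegral_mono_set (hω.integrableOn.mono_set (Ico_subset_Ico_left hr.1)) ?_
    (Ico_subset_Ico_left hrR).eventuallyLE
  exact (ae_restrict_iff' measurableSet_Ico).2 (Filter.Eventually.of_forall
    fun x hx => hω.nonneg x ⟨hr.1.trans hx.1, hx.2⟩)

theorem gridRadius_mem {K : ℝ} (hK : 2 ≤ K) (n : ℕ) : gridRadius K n ∈ Ico (0 : ℝ) 1 := by
  have h1 : 1 ≤ K ^ n := one_le_pow₀ (by linarith)
  have h2 : 0 < (K ^ n)⁻¹ := by positivity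
  have h3 : (K ^ n)⁻¹ ≤ 1 := inv_le_one_of_one_le₀ h1
  exact ⟨by rw [gridRadius]; linarith, by rw [gridRadius]; linarith⟩

theorem exists_isGrid {ω : ℝ → ℝ} (hω : IsDoubling ω) : ∃ K τ D : ℝ, IsGrid ω K τ D := by
  obtain ⟨⟨hw, C, hC, hup⟩, -, K₀, C₀, hK₀, hC₀, hlow⟩ := hω
  -- the lower doubling condition persists for larger `K`, as the tail integral is decreasing
  set K := max K₀ 2
  have hK2 : 2 ≤ K := le_max_right _ _
  have hmem : ∀ r ∈ Ico (0 : ℝ) 1, ∀ L : ℝ, 1 ≤ L → 1 - (1 - r) / L ∈ Ico (0 : ℝ) 1 := by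
    intro r hr L hL
    have h1 : (1 - r) / L ≤ 1 - r := div_le_self (by linarith [hr.2]) hL
    have h2 : 0 < (1 - r) / L := div_pos (by linarith [hr.2]) (by linarith)
    exact ⟨by linarith [hr.1], by linarith⟩
  have hmono : ∀ r ∈ Ico (0 : ℝ) 1, ∀ L L' : ℝ, 1 ≤ L → L ≤ L' →
      tail ω (1 - (1 - r) / L') ≤ tail ω (1 - (1 - r) / L) := by
    intro r hr L L' hL hLL'
    refine tail_antitoneOn hw (hmem r hr L hL) (hmem r hr L' (hL.trans hLL')) ?_
    have : (1 - r) / L' ≤ (1 - r) / L :=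
      div_le_div_of_nonneg_left (by linarith [hr.2]) (by linarith) hLL'
    linarith
  have hiter : ∀ n : ℕ, ∀ r ∈ Ico (0 : ℝ) 1, tail ω r ≤ C ^ n * tail ω (1 - (1 - r) / 2 ^ n) := by
    intro n
    induction n with
    | zero => intro r _; simp
    | succ n ih =>
      intro r hr
      have h1 := hup _ (hmem r hr (2 ^ n) (one_le_pow₀ (by norm_num)))
      have h2 : (1 + (1 - (1 - r) / 2 ^ n)) / 2 = 1 - (1 - r) / 2 ^ (n + 1) := by
        rw [pow_succ]; field_simp; ring
      rw [h2] at h1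
      calc _ ≤ _ := ih r hr
        _ ≤ C ^ n * (C * tail ω (1 - (1 - r) / 2 ^ (n + 1))) := by gcongr
        _ = _ := by ring
  obtain ⟨N, hN⟩ := pow_unbounded_of_one_lt K (one_lt_two (α := ℝ))
  have hstep : ∀ n, 1 - (1 - gridRadius K n) / K = gridRadius K (n + 1) := by
    intro n; rw [gridRadius, gridRadius, pow_succ]; field_simp; ring
  refine ⟨K, C₀⁻¹, C ^ N, hw, hK2, by positivity, inv_lt_one_of_one_lt₀ hC₀, fun n => ?_,
    fun n => ?_⟩
  · have hr := gridRadius_mem hK2 n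
    rw [← hstep n, ← div_eq_inv_mul, le_div_iff₀ (by linarith), mul_comm]
    refine le_trans ?_ (hlow _ hr)
    exact mul_le_mul_of_nonneg_left (hmono _ hr _ _ hK₀.le (le_max_left _ _)) (by linarith)
  · have hr := gridRadius_mem hK2 n
    rw [← hstep n]
    refine (hiter N _ hr).trans ?_
    exact mul_le_mul_of_nonneg_left (hmono _ hr _ _ (by linarith) hN.le) (by positivity)

namespace IsGrid

variable {ω : ℝ → ℝ} {K τ D : ℝ}

theorem pos_K (h : IsGrid ω K τ D) : 0 < K := by linarith [h.two_le]

theorem mem (h : IsGrid ω K τ D) (n : ℕ) : gridRadius K n ∈ Ico (0 : ℝ) 1 :=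
  gridRadius_mem h.two_le n

theorem strictMono (h : IsGrid ω K τ D) : StrictMono (gridRadius K) := by
  have hK := h.two_le
  refine strictMono_nat_of_lt_succ fun n => ?_
  rw [gridRadius, gridRadius]
  have : K ^ n < K ^ (n + 1) := pow_lt_pow_right₀ (by linarith) (Nat.lt_succ_self n)
  have h1 : 0 < K ^ n := pow_pos h.pos_K n
  have := inv_strictAnti₀ h1 this
  linarith

theorem gridTail_pos (h : IsGrid ω K τ D) (n : ℕ) : gridTail ω K n ≠ 0 := by
  simpa [gridTail] using h.weight.tail_pos _ (h.mem n)

theorem gridTail_succ_le (h : IsGrid ω K τ D) (n : ℕ) :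
    gridTail ω K (n + 1) ≤ ENNReal.ofReal τ * gridTail ω K n := by
  rw [gridTail, gridTail, ← ENNReal.ofReal_mul h.pos.le]
  exact ENNReal.ofReal_le_ofReal (h.succ_le n)

theorem gridTail_le_succ (h : IsGrid ω K τ D) (n : ℕ) :
    gridTail ω K n ≤ ENNReal.ofReal D * gridTail ω K (n + 1) := by
  rw [gridTail, gridTail, ← ENNReal.ofReal_mul' (h.weight.tail_pos _ (h.mem _)).le]
  exact ENNReal.ofReal_le_ofReal (h.le_succ n)

theorem gridTail_eq (h : IsGrid ω K τ D) (n : ℕ) :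
    gridTail ω K n = ∫⁻ r in Ico (gridRadius K n) 1, ENNReal.ofReal (ω r) := by
  rw [gridTail, tail, ofReal_integral_eq_lintegral_ofReal
    (h.weight.integrableOn.mono_set (Ico_subset_Ico_left (h.mem n).1))]
  exact (ae_restrict_iff' measurableSet_Ico).2 (Filter.Eventually.of_forall
    fun x hx => h.weight.nonneg x ⟨(h.mem n).1.trans hx.1, hx.2⟩)

theorem gridTail_eq_add (h : IsGrid ω K τ D) (n : ℕ) :
    gridTail ω K n = (∫⁻ r in Ico (gridRadius K n) (gridRadius K (n + 1)), ENNReal.ofReal (ω r))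
      + gridTail ω K (n + 1) := by
  rw [h.gridTail_eq, h.gridTail_eq, ← lintegral_union measurableSet_Ico,
    Ico_union_Ico_eq_Ico (h.strictMono (Nat.lt_succ_self n)).le (h.mem _).2.le]
  exact Ico_disjoint_Ico_same

/-- Each interval of the grid carries a fixed proportion of the tail integral at its left end. -/
theorem gridTail_le (h : IsGrid ω K τ D) (n : ℕ) :
    gridTail ω K n ≤ ENNReal.ofReal (1 / (1 - τ)) *
      ∫⁻ r in Ico (gridRadius K n) (gridRadius K (n + 1)), ENNReal.ofReal (ω r) := by
  refine le_mul_of_le_mul_add ENNReal.ofReal_ne_top h.pos.le h.lt_one ?_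
  nth_rw 1 [h.gridTail_eq_add n]
  rw [add_comm]
  gcongr
  exact h.gridTail_succ_le n

theorem iUnion_Ico (h : IsGrid ω K τ D) :
    ⋃ n, Ico (gridRadius K n) (gridRadius K (n + 1)) = Ico (0 : ℝ) 1 := by
  have hK := h.two_le
  ext x
  simp only [mem_iUnion]
  refine ⟨fun ⟨n, hn⟩ => ⟨(h.mem n).1.trans hn.1, hn.2.trans (h.mem _).2⟩, fun hx => ?_⟩
  obtain ⟨n, hn, hn'⟩ := exists_nat_pow_near (x := (1 - x)⁻¹) (y := K)
    ((one_le_inv₀ (by linarith [hx.2])).2 (by linarith [hx.1])) (by linarith)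
  have hx1 : 0 < 1 - x := by linarith [hx.2]
  have hKn : 0 < K ^ n := pow_pos h.pos_K n
  have hKn' : 0 < K ^ (n + 1) := pow_pos h.pos_K (n + 1)
  refine ⟨n, ?_, ?_⟩
  · have := (le_inv_comm₀ hKn hx1).1 hn
    rw [gridRadius]; linarith
  · have := (inv_lt_comm₀ hx1 hKn').1 hn'
    rw [gridRadius]; linarith

theorem lintegral_eq_tsum (h : IsGrid ω K τ D) (F : ℝ → ℝ≥0∞) :
    ∫⁻ r in Ico (0 : ℝ) 1, F r
      = ∑' n, ∫⁻ r in Ico (gridRadius K n) (gridRadius K (n + 1)), F r := by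
  rw [← h.iUnion_Ico, lintegral_iUnion (fun n => measurableSet_Ico)]
  exact h.strictMono.monotone.pairwise_disjoint_on_Ico_succ

theorem aemeasurable (h : IsGrid ω K τ D) (n : ℕ) : AEMeasurable (fun r => ENNReal.ofReal (ω r))
    (volume.restrict (Ico (gridRadius K n) (gridRadius K (n + 1)))) :=
  ((h.weight.integrableOn.mono_set (Ico_subset_Ico (h.mem n).1 (h.mem _).2.le)).aemeasurable
    ).ennreal_ofReal

/-- Integrals of increasing functions against `ω` are dominated by sums along the grid. -/
theorem lintegral_le_tsum (h : IsGrid ω K τ D) {N : ℝ → ℝ≥0∞} (hN : MonotoneOn N (Ico 0 1)) :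
    ∫⁻ r in Ico (0 : ℝ) 1, N r * ENNReal.ofReal (ω r) ≤
      ENNReal.ofReal D * ∑' n, N (gridRadius K (n + 1)) * gridTail ω K (n + 1) := by
  rw [h.lintegral_eq_tsum, ← ENNReal.tsum_mul_left]
  refine ENNReal.tsum_le_tsum fun n => ?_
  calc _ ≤ ∫⁻ r in Ico (gridRadius K n) (gridRadius K (n + 1)),
          N (gridRadius K (n + 1)) * ENNReal.ofReal (ω r) := by
        refine setLIntegral_mono' measurableSet_Ico fun r hr => ?_
        gcongr
        exact hN ⟨(h.mem n).1.trans hr.1, hr.2.trans (h.mem _).2⟩ (h.mem _) hr.2.le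
    _ = N (gridRadius K (n + 1)) *
          ∫⁻ r in Ico (gridRadius K n) (gridRadius K (n + 1)), ENNReal.ofReal (ω r) :=
        lintegral_const_mul'' _ (h.aemeasurable n)
    _ ≤ N (gridRadius K (n + 1)) * gridTail ω K n := by
        gcongr
        rw [h.gridTail_eq_add n]
        exact le_self_add
    _ ≤ N (gridRadius K (n + 1)) * (ENNReal.ofReal D * gridTail ω K (n + 1)) := by
        gcongr
        exact h.gridTail_le_succ n
    _ = _ := by ring

/-- Sums of an increasing function along the grid, with a power of the distance to the boundary,
are dominated by the integral against `ω`: on each interval of the grid this distance varies by a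
factor of at most `K`, and the interval carries a fixed proportion of the tail. -/
theorem tsum_le_lintegral (h : IsGrid ω K τ D) {N : ℝ → ℝ≥0∞} (hN : MonotoneOn N (Ico 0 1))
    (e : ℝ) :
    ∑' n, N (gridRadius K n) * ENNReal.ofReal ((K ^ n)⁻¹ ^ e) * gridTail ω K n ≤
      ENNReal.ofReal (K ^ |e| * (1 / (1 - τ))) *
        ∫⁻ r in Ico (0 : ℝ) 1, N r * ENNReal.ofReal ((1 - r) ^ e) * ENNReal.ofReal (ω r) := by
  have hK := h.two_le
  have hK0 := h.pos_K
  rw [h.lintegral_eq_tsum, ← ENNReal.tsum_mul_left]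
  refine ENNReal.tsum_le_tsum fun n => ?_
  have key : ∀ r ∈ Ico (gridRadius K n) (gridRadius K (n + 1)),
      ENNReal.ofReal ((K ^ n)⁻¹ ^ e) ≤ ENNReal.ofReal (K ^ |e|) * ENNReal.ofReal ((1 - r) ^ e) := by
    intro r hr
    rw [← ENNReal.ofReal_mul (by positivity)]
    refine ENNReal.ofReal_le_ofReal ?_
    set y := (K ^ n)⁻¹
    have hy0 : 0 < y := by positivity
    have hr1 : 1 - r ≤ y := by have := hr.1; rw [gridRadius] at this; linarith
    have hr2 : y / K ≤ 1 - r := by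
      have h1 := hr.2; rw [gridRadius, pow_succ, mul_inv] at h1
      rw [div_eq_mul_inv]; linarith
    have hr0 : 0 < 1 - r := (by positivity : 0 < y / K).trans_le hr2
    rcases le_total 0 e with he | he
    · rw [abs_of_nonneg he, ← Real.mul_rpow hK0.le hr0.le]
      refine Real.rpow_le_rpow hy0.le ?_ he
      rw [div_le_iff₀ hK0] at hr2; linarith
    · calc y ^ e ≤ (1 - r) ^ e := Real.rpow_le_rpow_of_nonpos hr0 hr1 he
        _ ≤ _ := le_mul_of_one_le_left (by positivity)
          (Real.one_le_rpow (by linarith) (abs_nonneg e))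
  calc N (gridRadius K n) * ENNReal.ofReal ((K ^ n)⁻¹ ^ e) * gridTail ω K n
      ≤ N (gridRadius K n) * ENNReal.ofReal ((K ^ n)⁻¹ ^ e) * (ENNReal.ofReal (1 / (1 - τ)) *
        ∫⁻ r in Ico (gridRadius K n) (gridRadius K (n + 1)), ENNReal.ofReal (ω r)) := by
        gcongr; exact h.gridTail_le n
    _ = ENNReal.ofReal (1 / (1 - τ)) *
        ∫⁻ r in Ico (gridRadius K n) (gridRadius K (n + 1)),
          N (gridRadius K n) * ENNReal.ofReal ((K ^ n)⁻¹ ^ e) * ENNReal.ofReal (ω r) := by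
        rw [lintegral_const_mul'' _ (h.aemeasurable n)]; ring
    _ ≤ ENNReal.ofReal (1 / (1 - τ)) *
        ∫⁻ r in Ico (gridRadius K n) (gridRadius K (n + 1)), ENNReal.ofReal (K ^ |e|) *
          (N r * ENNReal.ofReal ((1 - r) ^ e) * ENNReal.ofReal (ω r)) := by
        refine mul_le_mul_right (setLIntegral_mono' measurableSet_Ico fun r hr => ?_) _
        calc _ ≤ N r * (ENNReal.ofReal (K ^ |e|) * ENNReal.ofReal ((1 - r) ^ e))
              * ENNReal.ofReal (ω r) := by
              gcongr
              · exact hN (h.mem n) ⟨(h.mem n).1.trans hr.1, hr.2.trans (h.mem _).2⟩ hr.1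
              · exact key r hr
          _ = _ := by ring
    _ = _ := by
        rw [lintegral_const_mul' _ _ ENNReal.ofReal_ne_top, ← mul_assoc,
          ← ENNReal.ofReal_mul (by have := h.lt_one; have : 0 < 1 - τ := by linarith
                                   positivity), mul_comm (1 / (1 - τ))]

end IsGrid

/-! ### Products, and the operator `T_g` -/

theorem mean_congr {f g : ℂ → ℂ} (h : EqOn f g (ball 0 1)) (p : ℝ≥0∞) {r : ℝ}
    (hr : r ∈ Ico (0 : ℝ) 1) : mean p r f = mean p r g := by
  have h1 : ∀ z ∈ sphere (0 : ℂ) r, ‖f z‖ₑ = ‖g z‖ₑ := fun z hz => by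
    rw [h (sphere_subset_unitBall hr hz)]
  rw [mean, mean]
  split_ifs
  · exact biSup_congr h1
  · have h2 : ∀ θ, ‖f (circleMap 0 r θ)‖ₑ = ‖g (circleMap 0 r θ)‖ₑ :=
      fun θ => h1 _ (circleMap_mem_sphere 0 hr.1 θ)
    simp only [h2]

theorem mean_mul_le_top (f g : ℂ → ℂ) {s r : ℝ} (hs : 0 < s)
    (hf : ContinuousOn f (ball 0 1)) (hr : r ∈ Ico (0 : ℝ) 1) :
    mean (ENNReal.ofReal s) r (fun z => f z * g z) ≤ mean (ENNReal.ofReal s) r f * mean ∞ r g := by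
  rw [mean_ofReal hs, mean_ofReal hs]
  have h1 : ∀ θ, ‖f (circleMap 0 r θ) * g (circleMap 0 r θ)‖ₑ ^ s
      ≤ mean ∞ r g ^ s * ‖f (circleMap 0 r θ)‖ₑ ^ s := by
    intro θ
    rw [enorm_mul, mul_comm, ENNReal.mul_rpow_of_nonneg _ _ hs.le]
    gcongr
    rw [mean, if_pos rfl]
    exact le_iSup₂ (f := fun z (_ : z ∈ sphere (0 : ℂ) r) => ‖g z‖ₑ) _
      (circleMap_mem_sphere 0 hr.1 θ)
  have h2 := powMean_le_of_forall (f := fun z => f z * g z) h1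
  rw [lintegral_const_mul _ (measurable_enorm_rpow_circleMap hf hr s),
    lintegral_enorm_rpow_circleMap, mul_left_comm, ofReal_two_pi_mul_div] at h2
  calc _ ≤ (mean ∞ r g ^ s * powMean s r f) ^ (1 / s) := by gcongr
    _ = _ := by
      rw [ENNReal.mul_rpow_of_nonneg _ _ (by positivity), ← ENNReal.rpow_mul,
        mul_one_div_cancel hs.ne', ENNReal.rpow_one, mul_comm]

theorem tilde_pos {p s : ℝ} (hs : 0 < s) (hsp : s < p) : 0 < tilde p s :=
  inv_pos.2 (sub_pos.2 (one_div_lt_one_div_of_lt hs hsp))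

/-- Hölder's inequality for the integral means. -/
theorem mean_mul_le_of_lt {f g : ℂ → ℂ} {p s r : ℝ} (hs : 0 < s) (hsp : s < p)
    (hf : ContinuousOn f (ball 0 1)) (hg : ContinuousOn g (ball 0 1)) (hr : r ∈ Ico (0 : ℝ) 1) :
    mean (ENNReal.ofReal s) r (fun z => f z * g z) ≤
      mean (ENNReal.ofReal p) r f * mean (ENNReal.ofReal (tilde p s)) r g := by
  have ht := tilde_pos hs hsp
  rw [mean_ofReal hs, mean_ofReal (hs.trans hsp), mean_ofReal ht]
  set μ : Measure ℝ := (ENNReal.ofReal (2 * Real.pi))⁻¹ • volume.restrict (Ioc 0 (2 * Real.pi))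
  have hμ : ∀ (q : ℝ) (h : ℂ → ℂ), powMean q r h = ∫⁻ θ, ‖h (circleMap 0 r θ)‖ₑ ^ q ∂μ := by
    intro q h
    rw [lintegral_smul_measure, powMean, circleLAverage, ENNReal.div_eq_inv_mul, smul_eq_mul]
  have hm : ∀ h : ℂ → ℂ, ContinuousOn h (ball 0 1) →
      AEMeasurable (fun θ => ‖h (circleMap 0 r θ)‖ₑ) μ := fun h hh => by
    simpa using (measurable_enorm_rpow_circleMap hh hr 1).aemeasurable
  have := ENNReal.lintegral_Lp_mul_le_Lq_mul_Lr (r := tilde p s) hs hsp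
    (by rw [tilde, invTilde]; simp) μ (hm f hf) (hm g hg)
  rw [hμ, hμ, hμ]
  simpa only [Pi.mul_apply, enorm_mul] using this

/-- `T_g f` is the primitive of `f g'` in the disc that vanishes at the origin. -/
theorem hasDerivAt_T {f g : ℂ → ℂ} (hf : f ∈ H) (hg : g ∈ H) {z : ℂ} (hz : z ∈ ball (0 : ℂ) 1) :
    HasDerivAt (T g f) (f z * deriv g z) z := by
  have hφ : DifferentiableOn ℂ (fun z => f z * deriv g z) (ball 0 1) :=
    DifferentiableOn.mul hf (DifferentiableOn.deriv hg isOpen_ball)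
  obtain ⟨P, hP⟩ := hφ.isExactOn_ball
  have key : ∀ w ∈ ball (0 : ℂ) 1, T g f w = P w - P 0 := by
    intro w hw
    have hseg : ∀ x ∈ uIcc (0 : ℝ) 1, (x : ℂ) * w ∈ ball (0 : ℂ) 1 := by
      intro x hx
      rw [uIcc_of_le zero_le_one] at hx
      rw [mem_ball_zero_iff] at hw ⊢
      rw [norm_mul, Complex.norm_real, Real.norm_eq_abs, abs_of_nonneg hx.1]
      exact (mul_le_of_le_one_left (norm_nonneg w) hx.2).trans_lt hw
    have hder : ∀ x ∈ uIcc (0 : ℝ) 1, HasDerivAt (fun x : ℝ => P ((x : ℂ) * w))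
        ((f ((x : ℂ) * w) * deriv g ((x : ℂ) * w)) * w) x := by
      intro x hx
      exact HasDerivAt.comp_ofReal (e := fun y : ℂ => P (y * w))
        (HasDerivAt.comp (x : ℂ) (hP _ (hseg x hx)) (hasDerivAt_mul_const w))
    have hc : ContinuousOn (fun x : ℝ => (f ((x : ℂ) * w) * deriv g ((x : ℂ) * w)) * w)
        (uIcc 0 1) := by
      refine ContinuousOn.mul ?_ continuousOn_const
      exact hφ.continuousOn.comp (f := fun x : ℝ => (x : ℂ) * w) (by fun_prop) hseg
    have := intervalIntegral.integral_eq_sub_of_hasDerivAt hder hc.intervalIntegrable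
    rw [intervalIntegral.integral_mul_const] at this
    rw [T, mul_comm, this]
    simp
  refine ((hP z hz).sub_const (P 0)).congr_of_eventuallyEq ?_
  filter_upwards [isOpen_ball.mem_nhds hz] with w hw using key w hw

theorem T_mem_H {f g : ℂ → ℂ} (hf : f ∈ H) (hg : g ∈ H) : T g f ∈ H :=
  fun _ hz => (hasDerivAt_T hf hg hz).differentiableAt.differentiableWithinAt

theorem mean_zero_eq_zero {F : ℂ → ℂ} (hF : F 0 = 0) {s : ℝ} (hs : 0 < s) :
    mean (ENNReal.ofReal s) 0 F = 0 := by
  rw [mean_ofReal hs, powMean, circleLAverage]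
  simp [circleMap, hF, hs]

theorem mean_ne_top {F : ℂ → ℂ} (hF : ContinuousOn F (ball 0 1)) {s r : ℝ} (hs : 0 < s)
    (hr : r ∈ Ico (0 : ℝ) 1) : mean (ENNReal.ofReal s) r F ≠ ∞ := by
  rw [mean_ofReal hs]
  exact ENNReal.rpow_ne_top_of_nonneg (by positivity) (powMean_ne_top hF hs hr)

theorem monotoneOn_rpow {M : ℝ → ℝ≥0∞} {S : Set ℝ} (hM : MonotoneOn M S) {q : ℝ} (hq : 0 ≤ q) :
    MonotoneOn (fun r => M r ^ q) S :=
  fun _ hr _ hR hrR => ENNReal.rpow_le_rpow (hM hr hR hrR) hq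

/-! ### Littlewood–Paley estimate -/

namespace IsGrid

variable {ω : ℝ → ℝ} {K τ D : ℝ}

/-- Littlewood–Paley estimate: the mixed norm of `F` with `F 0 = 0` is controlled by
the integral means of `F'` along the grid. -/
theorem exists_mixedNorm_le (h : IsGrid ω K τ D) {s t : ℝ} (hs : 0 < s) (ht : 0 < t) :
    ∃ C : ℝ≥0∞, C ≠ ∞ ∧ ∀ F ∈ H, F 0 = 0 → mixedNorm ω (ENNReal.ofReal s) t F ≤
      C * (∑' n, (ENNReal.ofReal (K ^ n)⁻¹ *
        mean (ENNReal.ofReal s) (gridRadius K n) (deriv F)) ^ t * gridTail ω K n) ^ (1 / t) := by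
  have hK := h.two_le
  have hK0 := h.pos_K
  have hτ := h.pos
  -- `η * τ = √τ < 1`
  set η : ℝ := τ ^ (-(1 / 2) : ℝ)
  have hη1 : 1 < η := Real.one_lt_rpow_of_pos_of_lt_one_of_neg hτ h.lt_one (by norm_num)
  set b : ℝ := τ ^ (1 / 2 : ℝ) with hb
  have hb1 : b < 1 := Real.rpow_lt_one hτ.le h.lt_one (by norm_num)
  have hηb : η * τ = b := by
    calc η * τ = τ ^ (-(1 / 2) : ℝ) * τ ^ (1 : ℝ) := by rw [Real.rpow_one]
      _ = b := by rw [hb, ← Real.rpow_add hτ]; norm_num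
  obtain ⟨C₁, hC₁, hstep⟩ := exists_mean_rpow_le_add (κ := K) hs ht hη1
  set A : ℝ≥0∞ := C₁ * ENNReal.ofReal (K ^ 2) ^ t * ENNReal.ofReal D
  set B : ℝ≥0∞ := ENNReal.ofReal D * (ENNReal.ofReal (1 / (1 - b)) * A) with hB
  have hBtop : B ≠ ∞ := by finiteness
  refine ⟨B ^ (1 / t), by finiteness, fun F hF hF0 => ?_⟩
  set m := fun n => mean (ENNReal.ofReal s) (gridRadius K n) F with hm
  set z : ℕ → ℝ≥0∞ := fun n => (ENNReal.ofReal (K ^ n)⁻¹ *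
        mean (ENNReal.ofReal s) (gridRadius K n) (deriv F)) ^ t * gridTail ω K n
  have hrec : ∀ n, m (n + 1) ^ t * gridTail ω K (n + 1) ≤
      ENNReal.ofReal b * (m n ^ t * gridTail ω K n) + A * z (n + 2) := by
    intro n
    have hKn : 0 < (K ^ n)⁻¹ := by positivity
    have e1 : gridRadius K (n + 1) - gridRadius K n = (K ^ n)⁻¹ * (1 - 1 / K) := by
      rw [gridRadius, gridRadius, pow_succ]; field_simp; ring
    -- The next gap of the grid is the room left for the discs in the maximal inequality: it is
    -- `K` times smaller than the present one.
    have e2 : gridRadius K (n + 1) - gridRadius K n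
        = K * (gridRadius K (n + 2) - gridRadius K (n + 1)) := by
      rw [gridRadius, gridRadius, gridRadius, pow_succ, pow_succ]; field_simp; ring
    have h1 := hstep F hF (gridRadius K n) (gridRadius K (n + 1))
      (gridRadius K (n + 2) - gridRadius K (n + 1)) (gridRadius K (n + 2)) (h.mem n).1
      (h.strictMono (Nat.lt_succ_self n)).le (sub_pos.2 (h.strictMono (Nat.lt_succ_self _)))
      e2.le (by linarith) (h.mem _).2
    have h2 : ENNReal.ofReal (gridRadius K (n + 1) - gridRadius K n) ≤
        ENNReal.ofReal (K ^ 2) * ENNReal.ofReal (K ^ (n + 2))⁻¹ := by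
      rw [← ENNReal.ofReal_mul (by positivity), e1]
      refine ENNReal.ofReal_le_ofReal ?_
      have e3 : K ^ 2 * (K ^ (n + 2))⁻¹ = (K ^ n)⁻¹ := by rw [pow_add]; field_simp
      rw [e3]
      refine mul_le_of_le_one_right hKn.le ?_
      have : 0 < 1 / K := by positivity
      linarith
    set Q := mean (ENNReal.ofReal s) (gridRadius K (n + 2)) (deriv F)
    calc m (n + 1) ^ t * gridTail ω K (n + 1)
        ≤ (ENNReal.ofReal η * m n ^ t + C₁ * (ENNReal.ofReal (K ^ 2) *
            (ENNReal.ofReal (K ^ (n + 2))⁻¹ * Q)) ^ t) * gridTail ω K (n + 1) := by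
          gcongr
          refine h1.trans ?_
          rw [← mul_assoc (ENNReal.ofReal (K ^ 2))]
          gcongr
      _ = ENNReal.ofReal η * m n ^ t * gridTail ω K (n + 1) + C₁ * ENNReal.ofReal (K ^ 2) ^ t *
            (ENNReal.ofReal (K ^ (n + 2))⁻¹ * Q) ^ t * gridTail ω K (n + 1) := by
          rw [add_mul, ENNReal.mul_rpow_of_nonneg (ENNReal.ofReal (K ^ 2)) _ ht.le]
          ring
      _ ≤ ENNReal.ofReal η * m n ^ t * (ENNReal.ofReal τ * gridTail ω K n)
          + C₁ * ENNReal.ofReal (K ^ 2) ^ t * (ENNReal.ofReal (K ^ (n + 2))⁻¹ * Q) ^ t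
            * (ENNReal.ofReal D * gridTail ω K (n + 2)) := by
          gcongr
          · exact h.gridTail_succ_le n
          · exact h.gridTail_le_succ (n + 1)
      _ = _ := by
          rw [← hηb, ENNReal.ofReal_mul (by positivity)]
          ring
  have hx0 : m 0 ^ t * gridTail ω K 0 = 0 := by
    have : gridRadius K 0 = 0 := by simp [gridRadius]
    simp [hm, this, mean_zero_eq_zero hF0 hs, ht]
  have hsum := tsum_le_of_le_mul_add (x := fun n => m n ^ t * gridTail ω K n) hx0
    (fun n => ENNReal.mul_ne_top (ENNReal.rpow_ne_top_of_nonneg ht.le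
      (mean_ne_top (DifferentiableOn.continuousOn hF) hs (h.mem n))) ENNReal.ofReal_ne_top)
    (by positivity) hb1 hrec
  have hmono := monotoneOn_rpow (mean_ofReal_monotoneOn hF hs) ht.le
  rw [mixedNorm, ← ENNReal.mul_rpow_of_nonneg _ _ (by positivity)]
  gcongr
  calc _ ≤ _ := h.lintegral_le_tsum hmono
    _ ≤ ENNReal.ofReal D * (ENNReal.ofReal (1 / (1 - b)) * ∑' n, A * z (n + 2)) := by gcongr
    _ = B * ∑' n, z (n + 2) := by rw [ENNReal.tsum_mul_left, hB]; ring
    _ ≤ B * ∑' n, z n := 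
        mul_le_mul_right (ENNReal.tsum_comp_le_tsum_of_injective (add_left_injective 2) z) _

/-- The weighted `ℓ^q` norm of the integral means along the grid is controlled by
the mixed norm. -/
theorem exists_tsum_le_mixedNorm (h : IsGrid ω K τ D) {p q : ℝ} (hp : 0 < p) (hq : 0 < q) :
    ∃ C : ℝ≥0∞, C ≠ ∞ ∧ ∀ f ∈ H,
      (∑' n, mean (ENNReal.ofReal p) (gridRadius K (n + 1)) f ^ q * gridTail ω K n) ^ (1 / q) ≤
        C * mixedNorm ω (ENNReal.ofReal p) q f := by
  refine ⟨(ENNReal.ofReal D * ENNReal.ofReal (K ^ |(0 : ℝ)| * (1 / (1 - τ)))) ^ (1 / q),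
    by finiteness, fun f hf => ?_⟩
  have hmono := monotoneOn_rpow (mean_ofReal_monotoneOn hf hp) hq.le
  have h1 := h.tsum_le_lintegral hmono 0
  simp only [Real.rpow_zero, ENNReal.ofReal_one, mul_one] at h1
  rw [mixedNorm, ← ENNReal.mul_rpow_of_nonneg _ _ (by positivity)]
  gcongr
  set x : ℕ → ℝ≥0∞ := fun n => mean (ENNReal.ofReal p) (gridRadius K n) f ^ q * gridTail ω K n
  calc _ ≤ ∑' n, ENNReal.ofReal D * x (n + 1) := by
        refine ENNReal.tsum_le_tsum fun n => ?_
        calc _ ≤ mean (ENNReal.ofReal p) (gridRadius K (n + 1)) f ^ q *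
              (ENNReal.ofReal D * gridTail ω K (n + 1)) := by
              gcongr; exact h.gridTail_le_succ n
          _ = _ := mul_left_comm _ _ _
    _ = ENNReal.ofReal D * ∑' n, x (n + 1) := ENNReal.tsum_mul_left
    _ ≤ ENNReal.ofReal D * ∑' n, x n := 
        mul_le_mul_right (ENNReal.tsum_comp_le_tsum_of_injective (add_left_injective 1) x) _
    _ ≤ _ := mul_le_mul_right h1 _
    _ = _ := by rw [mul_assoc]

/-- Consecutive grid radii differ by at least half of the distance to the boundary. -/
theorem add_half_le (h : IsGrid ω K τ D) (n : ℕ) :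
    gridRadius K n + (K ^ n)⁻¹ / 2 ≤ gridRadius K (n + 1) := by
  have hK := h.two_le
  have hK0 := h.pos_K
  have : (K ^ (n + 1))⁻¹ ≤ (K ^ n)⁻¹ / 2 := by
    rw [pow_succ, mul_inv, div_eq_mul_inv]
    gcongr
  rw [gridRadius, gridRadius]; linarith

end IsGrid

/-! ### The norm of `T_g` and the symbol -/

/-- The sequence by which the integral means of `f` along the grid are multiplied, up to constants,
when passing from `M_p` of `f` to `M_s` of `f g'` times the distance to the boundary. For `p ≤ s`
it also contains the loss in passing from `M_p` to `M_s`. -/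
def symbolSeq (K p s : ℝ) (g : ℂ → ℂ) (n : ℕ) : ℝ≥0∞ :=
  if p ≤ s then
    ENNReal.ofReal ((K ^ n)⁻¹ ^ (1 + invTilde p s)) * mean ∞ (gridRadius K n) (deriv g)
  else ENNReal.ofReal (K ^ n)⁻¹ * mean (ENNReal.ofReal (tilde p s)) (gridRadius K n) (deriv g)

namespace IsGrid

variable {ω : ℝ → ℝ} {K τ D : ℝ}

theorem exists_mean_mul_le (h : IsGrid ω K τ D) {p s : ℝ} (hp : 0 < p) (hs : 0 < s) :
    ∃ C : ℝ≥0∞, C ≠ ∞ ∧ ∀ f ∈ H, ∀ g ∈ H, ∀ n,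
      ENNReal.ofReal (K ^ n)⁻¹ *
          mean (ENNReal.ofReal s) (gridRadius K n) (fun z => f z * deriv g z) ≤
        C * (mean (ENNReal.ofReal p) (gridRadius K (n + 1)) f * symbolSeq K p s g n) := by
  have hK0 := h.pos_K
  by_cases hps : p ≤ s
  · refine ⟨ENNReal.ofReal (8 ^ (1 / p - 1 / s)), ENNReal.ofReal_ne_top, fun f hf g hg n => ?_⟩
    have hy : 0 < (K ^ n)⁻¹ := by positivity
    rw [symbolSeq, if_pos hps]
    have h1 := mean_le_mean_of_le hf hp hps (h.mem n).1 (half_pos hy) (h.add_half_le n)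
      (h.mem (n + 1)).2
    have h2 := mean_mul_le_top f (deriv g) hs (DifferentiableOn.continuousOn hf) (h.mem n)
    set y := (K ^ n)⁻¹
    have h3 : ENNReal.ofReal y * ENNReal.ofReal ((4 / (y / 2)) ^ (1 / p - 1 / s))
        = ENNReal.ofReal (8 ^ (1 / p - 1 / s)) * ENNReal.ofReal (y ^ (1 + invTilde p s)) := by
      rw [← ENNReal.ofReal_mul hy.le, ← ENNReal.ofReal_mul (by positivity)]
      congr 1
      rw [show 4 / (y / 2) = 8 * y⁻¹ by field_simp; norm_num,
        Real.mul_rpow (by norm_num) (by positivity), Real.inv_rpow hy.le, ← Real.rpow_neg hy.le,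
        Real.rpow_add hy, Real.rpow_one, invTilde, neg_sub]
      ring
    calc _ ≤ ENNReal.ofReal y * (ENNReal.ofReal ((4 / (y / 2)) ^ (1 / p - 1 / s)) *
          mean (ENNReal.ofReal p) (gridRadius K (n + 1)) f *
          mean ∞ (gridRadius K n) (deriv g)) := by
          gcongr
          refine h2.trans ?_
          gcongr
      _ = ENNReal.ofReal y * ENNReal.ofReal ((4 / (y / 2)) ^ (1 / p - 1 / s)) *
          (mean (ENNReal.ofReal p) (gridRadius K (n + 1)) f *
          mean ∞ (gridRadius K n) (deriv g)) := by ring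
      _ = _ := by rw [h3]; ring
  · refine ⟨1, ENNReal.one_ne_top, fun f hf g hg n => ?_⟩
    rw [symbolSeq, if_neg hps, one_mul, mul_left_comm]
    gcongr
    refine (mean_mul_le_of_lt hs (not_le.1 hps) (DifferentiableOn.continuousOn hf)
      (DifferentiableOn.deriv hg isOpen_ball).continuousOn (h.mem n)).trans ?_
    gcongr
    exact mean_ofReal_monotoneOn hf hp (h.mem n) (h.mem _) (h.strictMono (Nat.lt_succ_self n)).le

/-- The norm of `T_g f` is controlled by the norm of multiplication by the symbol
sequence of `g`. -/
theorem exists_mixedNorm_T_le (h : IsGrid ω K τ D) {p q s t : ℝ} (hp : 0 < p) (hq : 0 < q)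
    (hs : 0 < s) (ht : 0 < t) :
    ∃ C : ℝ≥0∞, C ≠ ∞ ∧ ∀ f ∈ H, ∀ g ∈ H, mixedNorm ω (ENNReal.ofReal s) t (T g f) ≤
      C * (multiplierNorm (gridTail ω K) q t (symbolSeq K p s g) *
        mixedNorm ω (ENNReal.ofReal p) q f) := by
  obtain ⟨C₁, hC₁, h₁⟩ := h.exists_mixedNorm_le hs ht
  obtain ⟨C₂, hC₂, h₂⟩ := h.exists_mean_mul_le hp hs
  obtain ⟨C₃, hC₃, h₃⟩ := h.exists_tsum_le_mixedNorm hp hq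
  refine ⟨C₁ * C₂ * C₃, by finiteness, fun f hf g hg => ?_⟩
  set a := fun n => mean (ENNReal.ofReal p) (gridRadius K (n + 1)) f
  set b := symbolSeq K p s g
  set w := gridTail ω K
  have h4 : ∀ n, (ENNReal.ofReal (K ^ n)⁻¹ *
      mean (ENNReal.ofReal s) (gridRadius K n) (deriv (T g f))) ^ t * w n
      ≤ C₂ ^ t * ((a n * b n) ^ t * w n) := by
    intro n
    rw [mean_congr (fun z hz => (hasDerivAt_T hf hg hz).deriv) _ (h.mem n), ← mul_assoc,
      ← ENNReal.mul_rpow_of_nonneg _ _ ht.le]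
    exact mul_le_mul_left (ENNReal.rpow_le_rpow (h₂ f hf g hg n) ht.le) _
  calc _ ≤ C₁ * (∑' n, (ENNReal.ofReal (K ^ n)⁻¹ *
        mean (ENNReal.ofReal s) (gridRadius K n) (deriv (T g f))) ^ t * w n) ^ (1 / t) :=
        h₁ _ (T_mem_H hf hg) (by simp [T])
    _ ≤ C₁ * (∑' n, C₂ ^ t * ((a n * b n) ^ t * w n)) ^ (1 / t) := 
        mul_le_mul_right (ENNReal.rpow_le_rpow (ENNReal.tsum_le_tsum h4) (by positivity)) _
    _ ≤ C₁ * (C₂ ^ t * (multiplierNorm w q t b * (∑' n, a n ^ q * w n) ^ (1 / q)) ^ t)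
          ^ (1 / t) := by
        rw [ENNReal.tsum_mul_left]
        gcongr
        exact tsum_mul_rpow_le h.gridTail_pos (fun n => ENNReal.ofReal_ne_top) hq ht a b
    _ = C₁ * (C₂ * (multiplierNorm w q t b * (∑' n, a n ^ q * w n) ^ (1 / q))) := by
        rw [← ENNReal.mul_rpow_of_nonneg _ _ ht.le, ← ENNReal.rpow_mul, mul_one_div_cancel ht.ne',
          ENNReal.rpow_one]
    _ ≤ C₁ * (C₂ * (multiplierNorm w q t b * (C₃ * mixedNorm ω (ENNReal.ofReal p) q f))) := by
        gcongr; exact h₃ f hf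
    _ = _ := by ring

theorem gridTail_rpow (h : IsGrid ω K τ D) (n : ℕ) (e : ℝ) :
    gridTail ω K n ^ e = ENNReal.ofReal (tail ω (gridRadius K n) ^ e) := by
  rw [gridTail, ENNReal.ofReal_rpow_of_pos (h.weight.tail_pos _ (h.mem n))]

theorem multiplierNorm_le_supDisc (h : IsGrid ω K τ D) {p q s t : ℝ} (hps : p ≤ s) (hqt : q ≤ t)
    (g : ℂ → ℂ) :
    multiplierNorm (gridTail ω K) q t (symbolSeq K p s g) ≤ supDisc ω p q s t g := by
  have hK0 := h.pos_K
  rw [multiplierNorm, if_pos hqt]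
  refine iSup_le fun n => ?_
  rw [symbolSeq, if_pos hps, mean, if_pos rfl]
  simp only [ENNReal.mul_iSup, ENNReal.iSup_mul]
  refine iSup₂_le fun z hz => ?_
  refine le_trans (le_of_eq ?_) (le_iSup₂ (f := fun z (_ : z ∈ ball (0 : ℂ) 1) => ENNReal.ofReal
    (‖deriv g z‖ * tail ω ‖z‖ ^ invTilde q t * (1 - ‖z‖) ^ (1 + invTilde p s))) z
    (sphere_subset_unitBall (h.mem n) hz))
  have htail := h.weight.tail_pos _ (h.mem n)
  rw [mem_sphere_zero_iff_norm.1 hz, h.gridTail_rpow, ← ofReal_norm,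
    ← ENNReal.ofReal_mul (by positivity), ← ENNReal.ofReal_mul (by positivity)]
  have : 1 - gridRadius K n = (K ^ n)⁻¹ := by rw [gridRadius]; ring
  rw [this]
  congr 1; ring

theorem multiplierNorm_le_supMean (h : IsGrid ω K τ D) {p q s t : ℝ} (hsp : s < p) (hqt : q ≤ t)
    (g : ℂ → ℂ) :
    multiplierNorm (gridTail ω K) q t (symbolSeq K p s g) ≤ supMean ω p q s t g := by
  have hK0 := h.pos_K
  rw [multiplierNorm, if_pos hqt]
  refine iSup_le fun n => ?_
  rw [symbolSeq, if_neg hsp.not_ge]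
  refine le_trans (le_of_eq ?_) (le_iSup₂ (f := fun r (_ : r ∈ Ico (0 : ℝ) 1) =>
    ENNReal.ofReal ((1 - r) * tail ω r ^ invTilde q t) *
    mean (ENNReal.ofReal (tilde p s)) r (deriv g)) (gridRadius K n) (h.mem n))
  have : 1 - gridRadius K n = (K ^ n)⁻¹ := by rw [gridRadius]; ring
  rw [h.gridTail_rpow, this, ENNReal.ofReal_mul (by positivity)]
  ring

theorem mean_top_weighted {g : ℂ → ℂ} {r e : ℝ} (hr : r ∈ Ico (0 : ℝ) 1) :
    mean ∞ r (fun z => (((1 - ‖z‖) ^ e : ℝ) : ℂ) * deriv g z)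
      = ENNReal.ofReal ((1 - r) ^ e) * mean ∞ r (deriv g) := by
  simp only [mean, if_true, ENNReal.mul_iSup]
  refine biSup_congr fun z hz => ?_
  rw [mem_sphere_zero_iff_norm.1 hz, enorm_mul, ← ofReal_norm, Complex.norm_real,
    Real.norm_of_nonneg (Real.rpow_nonneg (by linarith [hr.2]) e)]

theorem exists_multiplierNorm_le_of_le_of_lt (h : IsGrid ω K τ D) {p q s t : ℝ} (hps : p ≤ s)
    (ht : 0 < t) (htq : t < q) :
    ∃ C : ℝ≥0∞, C ≠ ∞ ∧ ∀ g ∈ H, multiplierNorm (gridTail ω K) q t (symbolSeq K p s g) ≤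
      C * mixedNorm ω ∞ (tilde q t)
        (fun z => (((1 - ‖z‖) ^ (1 + invTilde p s) : ℝ) : ℂ) * deriv g z) := by
  have hK0 := h.pos_K
  have hu := tilde_pos ht htq
  set u := tilde q t
  set e := 1 + invTilde p s
  refine ⟨ENNReal.ofReal (K ^ |e * u| * (1 / (1 - τ))) ^ (1 / u), by finiteness, fun g hg => ?_⟩
  have hmono := monotoneOn_rpow (mean_top_monotoneOn (DifferentiableOn.deriv hg isOpen_ball)) hu.le
  rw [multiplierNorm, if_neg htq.not_ge, mixedNorm,
    ← ENNReal.mul_rpow_of_nonneg _ _ (by positivity)]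
  gcongr
  have hpow : ∀ y : ℝ, 0 < y → ∀ M : ℝ≥0∞,
      (ENNReal.ofReal (y ^ e) * M) ^ u = M ^ u * ENNReal.ofReal (y ^ (e * u)) := by
    intro y hy M
    rw [ENNReal.mul_rpow_of_nonneg _ _ hu.le, ENNReal.ofReal_rpow_of_pos (by positivity),
      ← Real.rpow_mul hy.le, mul_comm]
  calc _ = _ := by
        refine tsum_congr fun n => ?_
        rw [symbolSeq, if_pos hps, hpow _ (by positivity)]
    _ ≤ _ := h.tsum_le_lintegral hmono (e * u)
    _ = _ := by
        congr 1
        refine setLIntegral_congr_fun measurableSet_Ico fun r hr => ?_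
        rw [mean_top_weighted hr, hpow _ (by linarith [hr.2])]

theorem exists_multiplierNorm_le_of_lt_of_lt (h : IsGrid ω K τ D) {p q s t : ℝ} (hs : 0 < s)
    (hsp : s < p) (ht : 0 < t) (htq : t < q) :
    ∃ C : ℝ≥0∞, C ≠ ∞ ∧ ∀ g ∈ H, multiplierNorm (gridTail ω K) q t (symbolSeq K p s g) ≤
      C * mixedNorm ω (ENNReal.ofReal (tilde p s)) (tilde q t) g := by
  have hK0 := h.pos_K
  have hu := tilde_pos ht htq
  have hv := tilde_pos hs hsp
  set u := tilde q t
  set v := tilde p s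
  obtain ⟨C, hC, h₁⟩ := h.exists_tsum_le_mixedNorm hv hu
  refine ⟨ENNReal.ofReal (4 * 4 ^ (1 / v)) * C, by finiteness, fun g hg => ?_⟩
  have h2 : ∀ n, symbolSeq K p s g n ≤ ENNReal.ofReal (4 * 4 ^ (1 / v)) *
      mean (ENNReal.ofReal v) (gridRadius K (n + 1)) g := by
    intro n
    have hy : 0 < (K ^ n)⁻¹ := by positivity
    have h3 := mean_deriv_le (δ := (K ^ n)⁻¹ / 4) hg hv (h.mem n).1 (by positivity)
      (by linarith [h.add_half_le n]) (h.mem (n + 1)).2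
    rw [symbolSeq, if_neg hsp.not_ge]
    calc _ ≤ ENNReal.ofReal (K ^ n)⁻¹ * (ENNReal.ofReal (4 ^ (1 / v) / ((K ^ n)⁻¹ / 4)) *
          mean (ENNReal.ofReal v) (gridRadius K (n + 1)) g) := by gcongr
      _ = _ := by
          rw [← mul_assoc, ← ENNReal.ofReal_mul hy.le]
          congr 2; field_simp
  rw [multiplierNorm, if_neg htq.not_ge, mul_assoc]
  calc _ ≤ (∑' n, (ENNReal.ofReal (4 * 4 ^ (1 / v)) *
          mean (ENNReal.ofReal v) (gridRadius K (n + 1)) g) ^ u * gridTail ω K n) ^ (1 / u) := by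
        gcongr; exact h2 _
    _ = ENNReal.ofReal (4 * 4 ^ (1 / v)) *
          (∑' n, mean (ENNReal.ofReal v) (gridRadius K (n + 1)) g ^ u * gridTail ω K n)
            ^ (1 / u) := by
        simp only [ENNReal.mul_rpow_of_nonneg _ _ hu.le, mul_assoc]
        rw [ENNReal.tsum_mul_left, ENNReal.mul_rpow_of_nonneg _ _ (by positivity),
          ← ENNReal.rpow_mul, mul_one_div_cancel hu.ne', ENNReal.rpow_one]
    _ ≤ _ := by gcongr; exact h₁ g hg

end IsGrid

theorem symbolSeq_sub_const (K p s : ℝ) (g : ℂ → ℂ) (a : ℂ) :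
    symbolSeq K p s (fun z => g z - a) = symbolSeq K p s g := by
  have : deriv (fun z => g z - a) = deriv g := funext fun z => deriv_sub_const a
  funext n
  rw [symbolSeq, symbolSeq, this]

theorem IsGrid.exists_multiplierNorm_le_rho {ω : ℝ → ℝ} {K τ D : ℝ} (h : IsGrid ω K τ D)
    {p q s t : ℝ} (hs : 0 < s) (ht : 0 < t) :
    ∃ C : ℝ≥0∞, C ≠ ∞ ∧ ∀ g ∈ H, multiplierNorm (gridTail ω K) q t (symbolSeq K p s g) ≤
      C * rho ω p q s t g := by
  rcases le_or_gt p s with hps | hsp <;> rcases le_or_gt q t with hqt | htq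
  · refine ⟨1, ENNReal.one_ne_top, fun g _ => ?_⟩
    rw [rho, if_pos hps, if_pos hqt, one_mul]
    exact h.multiplierNorm_le_supDisc hps hqt g
  · simp only [rho, if_pos hps, if_neg htq.not_ge]
    exact h.exists_multiplierNorm_le_of_le_of_lt hps ht htq
  · refine ⟨1, ENNReal.one_ne_top, fun g _ => ?_⟩
    rw [rho, if_neg hsp.not_ge, if_pos hqt, one_mul]
    exact h.multiplierNorm_le_supMean hsp hqt g
  · obtain ⟨C, hC, hle⟩ := h.exists_multiplierNorm_le_of_lt_of_lt hs hsp ht htq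
    refine ⟨C, hC, fun g hg => ?_⟩
    rw [rho, if_neg hsp.not_ge, if_neg htq.not_ge, ← symbolSeq_sub_const K p s g (g 0)]
    exact hle _ (DifferentiableOn.sub_const hg (g 0))

/-- The two forms in which the weighted derivative is written have the same norm. -/
theorem mixedNorm_weighted_deriv (ω : ℝ → ℝ) (u e : ℝ) (g : ℂ → ℂ) :
    mixedNorm ω ∞ u (fun z => (((1 - ‖z‖) ^ e : ℝ) : ℂ) * deriv g z)
      = mixedNorm ω ∞ u (fun z => ((‖deriv g z‖ * (1 - ‖z‖) ^ e : ℝ) : ℂ)) := by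
  have : ∀ z : ℂ, ‖(((1 - ‖z‖) ^ e : ℝ) : ℂ) * deriv g z‖ₑ
      = ‖((‖deriv g z‖ * (1 - ‖z‖) ^ e : ℝ) : ℂ)‖ₑ := by
    intro z
    rw [← ofReal_norm, ← ofReal_norm, norm_mul, Complex.norm_real, Complex.norm_real, norm_mul,
      norm_norm, mul_comm]
  simp only [mixedNorm, mean, if_true, this]

theorem isBoundedOp_T {ω : ℝ → ℝ} {p q s t : ℝ} {g : ℂ → ℂ} (hg : g ∈ H) {C : ℝ≥0∞} (hC : C ≠ ∞)
    (h : ∀ f ∈ H, mixedNorm ω (ENNReal.ofReal s) t (T g f) ≤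
      C * mixedNorm ω (ENNReal.ofReal p) q f) :
    IsBoundedOp ω (ENNReal.ofReal p) q (ENNReal.ofReal s) t (T g) := by
  refine ⟨fun f hf => ⟨T_mem_H hf.1 hg, ?_, ?_⟩, C.toNNReal, fun f hf => ?_⟩
  · exact (DifferentiableOn.continuousOn (T_mem_H hf.1 hg)).domRestrict.measurable
  · exact (h f hf.1).trans_lt (ENNReal.mul_lt_top hC.lt_top hf.2.2)
  · rw [ENNReal.coe_toNNReal hC]
    exact h f hf.1

end MixedNorm

end

theorem mainTheorem10 (p q s t : ℝ) (hp : 0 < p) (hq : 0 < q) (hs : 0 < s) (ht : 0 < t)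
    (ω : ℝ → ℝ) (hω : MixedNorm.IsDoubling ω) :
    (∀ g ∈ MixedNorm.H,
      (p ≤ s → q ≤ t → MixedNorm.supDisc ω p q s t g < ∞ →
        MixedNorm.IsBoundedOp ω (ENNReal.ofReal p) q (ENNReal.ofReal s) t (MixedNorm.T g)) ∧
      (s < p → q ≤ t → MixedNorm.supMean ω p q s t g < ∞ →
        MixedNorm.IsBoundedOp ω (ENNReal.ofReal p) q (ENNReal.ofReal s) t (MixedNorm.T g)) ∧
      (p ≤ s → t < q →
        (fun z : ℂ => ((‖deriv g z‖ * (1 - ‖z‖) ^ (1 + MixedNorm.invTilde p s) : ℝ) : ℂ)) ∈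
          MixedNorm.L ω ∞ (MixedNorm.tilde q t) →
        MixedNorm.IsBoundedOp ω (ENNReal.ofReal p) q (ENNReal.ofReal s) t (MixedNorm.T g)) ∧
      (s < p → t < q →
        g ∈ MixedNorm.A ω (ENNReal.ofReal (MixedNorm.tilde p s)) (MixedNorm.tilde q t) →
        MixedNorm.IsBoundedOp ω (ENNReal.ofReal p) q (ENNReal.ofReal s) t (MixedNorm.T g))) ∧
    ∃ C : ℝ≥0, 0 < C ∧ ∀ g ∈ MixedNorm.H,
      MixedNorm.opNorm ω (ENNReal.ofReal p) q (ENNReal.ofReal s) t (MixedNorm.T g) ≤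
        C * MixedNorm.rho ω p q s t g := by
  obtain ⟨K, τ, D, h⟩ := MixedNorm.exists_isGrid hω
  obtain ⟨C₁, hC₁, hT⟩ := h.exists_mixedNorm_T_le hp hq hs ht
  obtain ⟨C₂, hC₂, hB⟩ := h.exists_multiplierNorm_le_rho (p := p) (q := q) hs ht
  have hbd : ∀ g ∈ MixedNorm.H,
      MixedNorm.multiplierNorm (MixedNorm.gridTail ω K) q t (MixedNorm.symbolSeq K p s g) < ∞ →
      MixedNorm.IsBoundedOp ω (ENNReal.ofReal p) q (ENNReal.ofReal s) t (MixedNorm.T g) :=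
    fun g hg hfin =>
    MixedNorm.isBoundedOp_T hg (ENNReal.mul_ne_top hC₁ hfin.ne)
      fun f hf => (hT f hf g hg).trans_eq (mul_assoc _ _ _).symm
  refine ⟨fun g hg => ⟨fun hps hqt hfin => ?_, fun hsp hqt hfin => ?_, fun hps htq hmem => ?_,
    fun hsp htq hmem => ?_⟩, (C₁ * C₂).toNNReal + 1, by positivity, fun g hg => ?_⟩
  · exact hbd g hg ((h.multiplierNorm_le_supDisc hps hqt g).trans_lt hfin)
  · exact hbd g hg ((h.multiplierNorm_le_supMean hsp hqt g).trans_lt hfin)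
  · obtain ⟨C, hC, hle⟩ := h.exists_multiplierNorm_le_of_le_of_lt hps ht htq
    refine hbd g hg ((hle g hg).trans_lt (ENNReal.mul_lt_top hC.lt_top ?_))
    rw [MixedNorm.mixedNorm_weighted_deriv]
    exact hmem.2
  · obtain ⟨C, hC, hle⟩ := h.exists_multiplierNorm_le_of_lt_of_lt hs hsp ht htq
    exact hbd g hg ((hle g hg).trans_lt (ENNReal.mul_lt_top hC.lt_top hmem.2.2))
  · refine sInf_le fun f hf => (hT f hf.1 g hg).trans ?_
    rw [← mul_assoc]
    refine mul_le_mul_left ?_ _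
    calc C₁ * MixedNorm.multiplierNorm (MixedNorm.gridTail ω K) q t (MixedNorm.symbolSeq K p s g)
        ≤ C₁ * (C₂ * MixedNorm.rho ω p q s t g) := mul_le_mul_right (hB g hg) _
      _ = (C₁ * C₂) * MixedNorm.rho ω p q s t g := (mul_assoc _ _ _).symm
      _ ≤ _ := by
        refine mul_le_mul_left ?_ _
        rw [ENNReal.coe_add, ENNReal.coe_toNNReal (ENNReal.mul_ne_top hC₁ hC₂)]
        exact le_self_add
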